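/- Let $m>0$ and let $E$ be a (bosonic) massive particle bundle of mass $m$ and spin $s$: a smooth Hermitian vector bundle of rank $2s+1\ge 1$ over the mass hyperboloid $\{(\omega,\mathbf k):\omega=\sqrt{|\mathbf k|^2+m^2}\}\cong\mathbb R^3$ with a smooth, fibrewise unitary, irreducible action $\Sigma$ of the proper orthochronous Poincaré group covering its action on momenta, the translation by $b$ acting on the fibre over $\mathbf k$ as $e^{i(\omega b^0-\mathbf k\cdot\mathbf b)}$. The group acts on sections by $(\tilde\Sigma_\Lambda\psi)(\mathbf k)=\Sigma_\Lambda[\psi(\Lambda^{-1}\mathbf k)]$. Put $J_a\psi=i\frac{d}{dt}|_{t=0}\tilde\Sigma_{R_a(t)}\psi$ and $K_a\psi=-i\frac{d}{dt}|_{t=0}\tilde\Sigma_{\Lambda_a(t)}\psi$, where $R_a(t)$ and $\Lambda_a(t)$ are the rotation about and the boost along the $a$-th axis, $\mathbf P\psi=\mathbf k\psi$, $H\psi=\omega\psi$, $\hat{\mathbf P}=\mathbf P/|\mathbf P|$, $J_k=\hat{\mathbf P}\cdot\mathbf J$, and $$\mathbf D^K=-\frac iH\Big(\mathbf K-\frac{i\mathbf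 P}{2H}\Big),\qquad \mathbf D^R=-i\Big(\frac{\hat{\mathbf P}\times\mathbf J}{|\mathbf P|}+\frac1H\hat{\mathbf P}(\hat{\mathbf P}\cdot\mathbf K)-\frac{i\mathbf P}{2H^2}\Big).$$ The curvature of a connection $D$ is $F_D(X,Y)=D_XD_Y-D_YD_X-D_{[X,Y]}$; $D$ is called $S^2$-flat if $F_D(X,Y)=0$ for all vector fields $X,Y$ on $\mathbb R^3\setminus\{0\}$ that are everywhere orthogonal to $\mathbf k$. (1) For every radial $f=f(|\mathbf k|)$, smooth on $\mathbb R^3\setminus\{0\}$ (possibly complex-valued), $\mathbf D^f=f\mathbf D^K+(1-f)\mathbf D^R$ is a connection on $E|_{\mathbb R^3\setminus\{0\}}$, and for vector fields $X,Y$ orthogonal to $\mathbf k$, smooth on an open subset of $\mathbb R^3\setminus\{0\}$, $$F^f(X,Y)=i\Big(\frac{f^2}{H^2}+\frac{1-f^2}{|\mathbf P|^2}\Big)\,\big(\hat{\mathbf k}\cdot(X\times Y)\big)\,J_k ;$$ in particular, off the third axis, $F^f(\hat{\mathbf e}_\theta,\hat{\mathbf e}_\phi)=i\big(\frac{f^2}{H^2}+\frac{1-f^2}{|\mathbf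 P|^2}\big)J_k$ for the spherical unit vectors. (2) If the spin is not zero (rank $>1$), then $\mathbf D^f$ is $S^2$-flat if and only if $f=H/m$ on all of $\mathbb R^3\setminus\{0\}$ or $f=-H/m$ on all of $\mathbb R^3\setminus\{0\}$. (3) If the spin is not zero, then $\mathbf D^f$ is $S^2$-flat and also regular at $\mathbf k=0$ (that is, it is the restriction of a smooth connection on $E$ over all of $\mathbb R^3$) if and only if $f=f_+=H/m$. The connection $\mathbf D^-$ given by $f_-=-H/m$ is singular at the origin: there are a smooth vector field $X$ and a smooth section $\psi$ on $\mathbb R^3$ for which $\mathbf D^-_X\psi$ is unbounded in every punctured neighbourhood of $0$. (4) For every spin, $\mathbf D^+=\frac Hm\mathbf D^K+\big(1-\frac Hm\big)\mathbf D^R$ satisfies, over $\mathbb R^3\setminus\{0\}$, $i\mathbf D^+=\mathbf Q^{NW}$, where $$\mathbf Q^{NW}=\frac1H\Big(\mathbf K-\frac{i\mathbf P}{2H}\Big)-\frac1{mH(H+m)}\mathbf P\times(H\mathbf J+\mathbf P\times\mathbf K)$$ is the Newton–Wigner position operator; and $-i\mathbf Q^{NW}$ is a connection on $E$ over all of $\mathbb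 R^3$, with identically vanishing curvature. -/

import Mathlib

open scoped ContDiff

noncomputable section

namespace Particle

/-- Three-momentum space `ℝ³`. The mass hyperboloid is identified with it by forgetting the energy. -/
abbrev Mom : Type := EuclideanSpace ℝ (Fin 3)

/-- The cross product on `ℝ³`. -/
def cross (u v : Mom) : Mom :=
  WithLp.toLp 2 ![u 1 * v 2 - u 2 * v 1, u 2 * v 0 - u 0 * v 2, u 0 * v 1 - u 1 * v 0]

/-! ### The Poincare group and its action on momenta -/

/-- The Minkowski metric, signature `(+,-,-,-)`. -/
def eta : Matrix (Fin 4) (Fin 4) ℝ := Matrix.diagonal ![1, -1, -1, -1]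

/-- The proper orthochronous Lorentz group `SO⁺(3,1)`, as a set of matrices. -/
def lorentz : Set (Matrix (Fin 4) (Fin 4) ℝ) :=
  {L | L.transpose * eta * L = eta ∧ L.det = 1 ∧ 0 < L 0 0}

/-- Minkowski product of four-vectors. -/
def mink (p b : Fin 4 → ℝ) : ℝ := p 0 * b 0 - ∑ a : Fin 3, p a.succ * b a.succ

/-- The energy `ω(r) = √(r² + m²)` of a particle of mass `m` and momentum of length `r`. -/
def energy (m r : ℝ) : ℝ := Real.sqrt (r ^ 2 + m ^ 2)

/-- The four-momentum `(ω, k)` on the mass shell. -/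
def fourMom (m : ℝ) (k : Mom) : Fin 4 → ℝ := Fin.cons (energy m ‖k‖) (fun a => k a)

/-- The action of a Lorentz matrix on (three-)momenta: the space part of `Λ (ω, k)`. -/
def lorentzAct (m : ℝ) (L : Matrix (Fin 4) (Fin 4) ℝ) (k : Mom) : Mom :=
  WithLp.toLp 2 (fun a : Fin 3 => (L.mulVec (fourMom m k)) a.succ)

/-- `rotation a t`: rotation by the angle `t` about the `a`-th axis. -/
def rotation (a : Fin 3) (t : ℝ) : Matrix (Fin 4) (Fin 4) ℝ :=
  ![!![1, 0, 0, 0; 0, 1, 0, 0; 0, 0, Real.cos t, -Real.sin t; 0, 0, Real.sin t, Real.cos t],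
    !![1, 0, 0, 0; 0, Real.cos t, 0, Real.sin t; 0, 0, 1, 0; 0, -Real.sin t, 0, Real.cos t],
    !![1, 0, 0, 0; 0, Real.cos t, -Real.sin t, 0; 0, Real.sin t, Real.cos t, 0; 0, 0, 0, 1]] a

/-- `boost a t`: boost in the direction of the `a`-th axis with rapidity `t`, that is, with
velocity `tanh t = t + O(t³)`; the parametrisations by rapidity and by velocity have the same
derivative at `t = 0`. -/
def boost (a : Fin 3) (t : ℝ) : Matrix (Fin 4) (Fin 4) ℝ :=
  ![!![Real.cosh t, Real.sinh t, 0, 0; Real.sinh t, Real.cosh t, 0, 0; 0, 0, 1, 0; 0, 0, 0, 1],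
    !![Real.cosh t, 0, Real.sinh t, 0; 0, 1, 0, 0; Real.sinh t, 0, Real.cosh t, 0; 0, 0, 0, 1],
    !![Real.cosh t, 0, 0, Real.sinh t; 0, 1, 0, 0; 0, 0, 1, 0; Real.sinh t, 0, 0, Real.cosh t]] a

/-! ### Particle bundles -/

/-- A bosonic particle bundle of mass `m`: a smooth unitary irreducible bundle representation of
the Poincare group over the mass-`m` hyperboloid. The hyperboloid is `ℝ³`, over which every
Hermitian vector bundle is isomorphic to a product `ℝ³ × V`, so the total space is `ℝ³ × V`. The
Poincare transformation `x ↦ Λ x + b` sends `(k, v)` to `(Λ k, act Λ b k v)`. The value of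
`act Λ b` matters only for `Λ` in the proper orthochronous Lorentz group. -/
structure Bundle (m : ℝ) (V : Type*) [NormedAddCommGroup V] [InnerProductSpace ℂ V] where
  act : Matrix (Fin 4) (Fin 4) ℝ → (Fin 4 → ℝ) → Mom → V →L[ℂ] V
  nontrivial : Nontrivial V
  act_one : ∀ k, act 1 0 k = ContinuousLinearMap.id ℂ V
  act_mul : ∀ L₁ ∈ lorentz, ∀ L₂ ∈ lorentz, ∀ (b₁ b₂ : Fin 4 → ℝ) (k : Mom),
    act (L₁ * L₂) (L₁.mulVec b₂ + b₁) k = (act L₁ b₁ (lorentzAct m L₂ k)).comp (act L₂ b₂ k)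
  /-- The vectors in the fibre over `k` are eigenstates of four-momentum `(ω, k)`. -/
  act_translation : ∀ (b : Fin 4 → ℝ) (k : Mom),
    act 1 b k = Complex.exp (Complex.I * (mink (fourMom m k) b : ℂ)) • ContinuousLinearMap.id ℂ V
  act_unitary : ∀ L ∈ lorentz, ∀ (b : Fin 4 → ℝ) (k : Mom) (v w : V),
    inner ℂ (act L b k v) (act L b k w) = inner ℂ v w
  /-- Smoothness on the submanifold of Lorentz matrices. -/
  act_smooth : ContDiffOn ℝ ∞
    (fun p : (Fin 4 → Fin 4 → ℝ) × (Fin 4 → ℝ) × Mom => act (Matrix.of p.1) p.2.1 p.2.2)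
    {p | Matrix.of p.1 ∈ lorentz}
  /-- No proper invariant subbundle. The group acts smoothly and transitively on the base, so an
  invariant family of subspaces automatically has constant rank and is a smooth subbundle. -/
  irreducible : ∀ W : Mom → Submodule ℂ V,
    (∀ L ∈ lorentz, ∀ (b : Fin 4 → ℝ) (k : Mom), ∀ v ∈ W k, act L b k v ∈ W (lorentzAct m L k)) →
    (∀ k, W k = ⊥) ∨ (∀ k, W k = ⊤)

/-- Operators on wave functions (sections of the bundle). -/
abbrev Op (V : Type*) : Type _ := (Mom → V) → (Mom → V)

/-- Maps `(X, ψ) ↦ D_X ψ` from vector fields and sections to sections. -/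
abbrev ConnOp (V : Type*) : Type _ := (Mom → Mom) → (Mom → V) → (Mom → V)

section Connections

variable {V : Type*} [NormedAddCommGroup V] [InnerProductSpace ℂ V]

/-- `D` is a (smooth) connection on the restriction of the bundle to the open set `U`. -/
structure IsConnectionOn (U : Set Mom) (D : ConnOp V) : Prop where
  smooth : ∀ X ψ, ContDiffOn ℝ ∞ X U → ContDiffOn ℝ ∞ ψ U → ContDiffOn ℝ ∞ (D X ψ) U
  /-- Over `U`, the section `D_X ψ` depends only on `X` and `ψ` over `U`. -/
  congr : ∀ X X₁ ψ ψ₁, ContDiffOn ℝ ∞ X U → ContDiffOn ℝ ∞ ψ U →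
    Set.EqOn X X₁ U → Set.EqOn ψ ψ₁ U → Set.EqOn (D X ψ) (D X₁ ψ₁) U
  add_field : ∀ X Y ψ, ContDiffOn ℝ ∞ X U → ContDiffOn ℝ ∞ Y U → ContDiffOn ℝ ∞ ψ U →
    ∀ k ∈ U, D (X + Y) ψ k = D X ψ k + D Y ψ k
  smul_field : ∀ (g : Mom → ℝ) X ψ, ContDiffOn ℝ ∞ g U → ContDiffOn ℝ ∞ X U →
    ContDiffOn ℝ ∞ ψ U → ∀ k ∈ U, D (fun q => g q • X q) ψ k = g k • D X ψ k
  add_section : ∀ X ψ χ, ContDiffOn ℝ ∞ X U → ContDiffOn ℝ ∞ ψ U → ContDiffOn ℝ ∞ χ U →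
    ∀ k ∈ U, D X (ψ + χ) k = D X ψ k + D X χ k
  leibniz : ∀ (g : Mom → ℂ) X ψ, ContDiffOn ℝ ∞ g U → ContDiffOn ℝ ∞ X U →
    ContDiffOn ℝ ∞ ψ U → ∀ k ∈ U,
      D X (fun q => g q • ψ q) k = (fderiv ℝ g k (X k)) • ψ k + g k • D X ψ k

/-- The curvature `F_D(X,Y) ψ = D_X D_Y ψ - D_Y D_X ψ - D_[X,Y] ψ`. -/
def curvature (D : ConnOp V) (X Y : Mom → Mom) : Op V := fun ψ =>
  D X (D Y ψ) - D Y (D X ψ) - D (VectorField.lieBracket ℝ X Y) ψ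

/-- `X` is tangent to the spheres centred at the origin, at all points of `U`. -/
def TransverseOn (U : Set Mom) (X : Mom → Mom) : Prop := ∀ k ∈ U, inner ℝ (X k) k = 0

/-- Flatness over the open set `U`. -/
def IsFlatOn (U : Set Mom) (D : ConnOp V) : Prop :=
  ∀ X Y ψ, ContDiffOn ℝ ∞ X U → ContDiffOn ℝ ∞ Y U → ContDiffOn ℝ ∞ ψ U →
    ∀ k ∈ U, curvature D X Y ψ k = 0

/-- `S²`-flatness of a connection over `ℝ³ ∖ {0}`: the curvature vanishes on all pairs of vector
fields transverse to `k`. -/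
def IsS2Flat (D : ConnOp V) : Prop :=
  ∀ X Y ψ, ContDiffOn ℝ ∞ X {0}ᶜ → ContDiffOn ℝ ∞ Y {0}ᶜ → ContDiffOn ℝ ∞ ψ {0}ᶜ →
    TransverseOn {0}ᶜ X → TransverseOn {0}ᶜ Y → ∀ k ≠ 0, curvature D X Y ψ k = 0

/-- A connection over `ℝ³ ∖ {0}` is regular at the origin if it is the restriction of a connection
over all of `ℝ³`. -/
def IsRegularAtOrigin (D : ConnOp V) : Prop :=
  ∃ D₀ : ConnOp V, IsConnectionOn Set.univ D₀ ∧
    ∀ X ψ, ContDiff ℝ ∞ X → ContDiff ℝ ∞ ψ → ∀ k ≠ 0, D X ψ k = D₀ X ψ k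

/-- The map `(X, ψ) ↦ (X · D) ψ` with the Cartesian components `D a`. -/
def ofComponents (D : Fin 3 → Op V) : ConnOp V := fun X ψ k =>
  ∑ a, ((X k a : ℝ) : ℂ) • D a ψ k

/-- Multiplication of sections by a function. -/
def mulOp (g : Mom → ℂ) : Op V := fun ψ k => g k • ψ k

/-- The cross product of two triples of operators:
`(A × B)_a = A_{a+1} B_{a+2} - A_{a+2} B_{a+1}`, with indices modulo 3. -/
def opCross (A B : Fin 3 → Op V) : Fin 3 → Op V := fun a ψ =>
  A (a + 1) (B (a + 2) ψ) - A (a + 2) (B (a + 1) ψ)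

/-- The scalar product of two triples of operators. -/
def opDot (A B : Fin 3 → Op V) : Op V := fun ψ => ∑ a, A a (B a ψ)

/-- The momentum operators `P`. -/
def opP (a : Fin 3) : Op V := mulOp fun k => (k a : ℂ)

/-- The components of `P / |P|`. -/
def opPhat (a : Fin 3) : Op V := mulOp fun k => ((k a / ‖k‖ : ℝ) : ℂ)

/-- The operator `g(|P|)`. -/
def radial (g : ℝ → ℂ) : Op V := mulOp fun k => g ‖k‖

end Connections

/-- The spherical unit vector `e_θ`, off the third axis. -/
def eTheta (k : Mom) : Mom :=
  WithLp.toLp 2 ![k 2 / ‖k‖ * (k 0 / Real.sqrt (k 0 ^ 2 + k 1 ^ 2)),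
    k 2 / ‖k‖ * (k 1 / Real.sqrt (k 0 ^ 2 + k 1 ^ 2)), -(Real.sqrt (k 0 ^ 2 + k 1 ^ 2) / ‖k‖)]

/-- The spherical unit vector `e_φ`, off the third axis. -/
def ePhi (k : Mom) : Mom :=
  WithLp.toLp 2 ![-(k 1 / Real.sqrt (k 0 ^ 2 + k 1 ^ 2)), k 0 / Real.sqrt (k 0 ^ 2 + k 1 ^ 2), 0]

namespace Bundle

variable {m : ℝ} {V : Type*} [NormedAddCommGroup V] [InnerProductSpace ℂ V] (E : Bundle m V)

/-- The induced representation on wave functions: `(Λ, b) ψ (k) = Σ_(Λ, b) [ψ (Λ⁻¹ k)]`. -/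
def rep (L : Matrix (Fin 4) (Fin 4) ℝ) (b : Fin 4 → ℝ) : Op V := fun ψ k =>
  E.act L b (lorentzAct m L⁻¹ k) (ψ (lorentzAct m L⁻¹ k))

/-- The angular momentum operators `J_a`. -/
def J (a : Fin 3) : Op V := fun ψ k =>
  Complex.I • deriv (fun t : ℝ => E.rep (rotation a t) 0 ψ k) 0

/-- The boost generators `K_a`. -/
def K (a : Fin 3) : Op V := fun ψ k =>
  -(Complex.I • deriv (fun t : ℝ => E.rep (boost a t) 0 ψ k) 0)

/-- The powers `H ^ n`, `n ∈ ℤ`, of the Hamiltonian `H = √(|P|² + m²)`. -/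
def Hpow (_E : Bundle m V) (n : ℤ) : Op V := radial fun r => (energy m r : ℂ) ^ n

/-- The helicity operator `J_k = (P / |P|) · J`. -/
def Jk : Op V := opDot opPhat E.J

/-- Components of the boost connection `D^K = -(i/H) (K - i P / (2H))`. -/
def boostComp (a : Fin 3) : Op V := fun ψ =>
  -(Complex.I • E.Hpow (-1) (E.K a ψ - (Complex.I / 2) • E.Hpow (-1) (opP a ψ)))

/-- Components of the rotation connection
`D^R = -i ((P/|P|) × J / |P| + H⁻¹ (P/|P|) ((P/|P|) · K) - i P / (2 H²))`. -/
def rotComp (a : Fin 3) : Op V := fun ψ =>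
  -(Complex.I • (radial (fun r => ((r⁻¹ : ℝ) : ℂ)) (opCross opPhat E.J a ψ)
    + E.Hpow (-1) (opPhat a (opDot opPhat E.K ψ))
    - (Complex.I / 2) • E.Hpow (-2) (opP a ψ)))

/-- The affine combination `D^f = f D^K + (1 - f) D^R` with `f = f(|k|)`. -/
def affineComb (f : ℝ → ℂ) : ConnOp V :=
  ofComponents fun a ψ =>
    radial f (E.boostComp a ψ) + radial (fun r => 1 - f r) (E.rotComp a ψ)

/-- The Newton-Wigner position operator
`Q = H⁻¹ (K - i P / (2H)) - (m H (H + m))⁻¹ P × (H J + P × K)`. -/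
def newtonWigner (a : Fin 3) : Op V := fun ψ =>
  E.Hpow (-1) (E.K a ψ - (Complex.I / 2) • E.Hpow (-1) (opP a ψ))
  - radial (fun r => ((m * energy m r * (energy m r + m) : ℝ) : ℂ)⁻¹)
      (opCross opP (fun b χ => E.Hpow 1 (E.J b χ) + opCross opP E.K b χ) a ψ)

end Bundle

end Particle

end

noncomputable section

namespace Particle

/-! ### The Lorentz group -/

/-! Everything is computed in one global trivialisation. Let `L_k` be the rotation-free boost taking
the rest momentum `0` to `k`; its action `gauge k` identifies the fibre over `0` with the fibre over
`k`. A Lorentz transformation `Λ` then acts through its Wigner rotation `L_{Λk}⁻¹ Λ L_k` in the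
stabilizer of `0`. For a rotation this is the rotation itself; for an infinitesimal boost along
`e_a` it is the infinitesimal rotation about `k × e_a / (ω + m)`. With `S` the derivative of the
little-group action, `J_a` becomes `i (S(e_a) - ∂_{e_a × k})` and `K_a` becomes `-i (S(k × e_a) / (ω
+ m) - ω ∂_a)` (`J_eq`, `K_eq`).

Hence every connection in question has the form `∂_X - X·k / (2ω²) + g S(X × k)` (`gaugeConn`), with
`g = (1 - f m/ω) / r²`, `r = |k|`, for `D^f` (`affineComb_eq`) and `g = 0` for `-i Q^{NW}`
(`newtonWigner_eq`). The scalar term is the exact form `-½ d log ω` and has no curvature. By `[S(u),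
S(v)] = S(u × v)`, the curvature on fields orthogonal to `k` is `(g² - 2g/r²) (k·(X × Y)) S(k)`.
Completing the square with `1 - g r² = f m/ω` gives the stated formula, since `J_k = i S(k)/r`
(`curvature_affineComb`).

The scalar factor equals `(ω² - m² f²) / (ω² r²)`. So, if `S ≠ 0`, being `S²`-flat means `f² =
(ω/m)²`, and continuity on the connected half-line fixes one sign. For `f = ω/m` the coefficient `g`
vanishes, leaving the Newton–Wigner connection; for `f = -ω/m` it is `2/r²` and the spin term grows
like `1/r`. Finally `S ≠ 0` when the rank exceeds one: otherwise the connected stabilizer of `0`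
acts trivially, and a single vector transported by the `L_k` spans an invariant line subbundle,
against irreducibility (`exists_spin_ne_zero`). -/

lemma norm_sq_eq_coords (k : Mom) : ‖k‖ ^ 2 = k 0 ^ 2 + k 1 ^ 2 + k 2 ^ 2 := by
  rw [EuclideanSpace.real_norm_sq_eq, Fin.sum_univ_three]

lemma inner_eq_coords (u v : Mom) : inner ℝ u v = u 0 * v 0 + u 1 * v 1 + u 2 * v 2 := by
  simp [PiLp.inner_apply, Fin.sum_univ_three]; ring

lemma energy_sq (m r : ℝ) : energy m r ^ 2 = r ^ 2 + m ^ 2 :=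
  Real.sq_sqrt (by positivity)

lemma energy_sq_coords (m : ℝ) (k : Mom) :
    energy m ‖k‖ ^ 2 = k 0 ^ 2 + k 1 ^ 2 + k 2 ^ 2 + m ^ 2 := by
  rw [energy_sq, norm_sq_eq_coords]

lemma energy_pos {m : ℝ} (hm : 0 < m) (r : ℝ) : 0 < energy m r :=
  Real.sqrt_pos.2 (by positivity)

lemma energy_zero {m : ℝ} (hm : 0 < m) : energy m 0 = m := by
  simp [energy, Real.sqrt_sq hm.le]

@[simp] lemma fourMom_zero (m : ℝ) (k : Mom) : fourMom m k 0 = energy m ‖k‖ := rfl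
@[simp] lemma fourMom_one (m : ℝ) (k : Mom) : fourMom m k 1 = k 0 := rfl
@[simp] lemma fourMom_two (m : ℝ) (k : Mom) : fourMom m k 2 = k 1 := rfl
@[simp] lemma fourMom_three (m : ℝ) (k : Mom) : fourMom m k 3 = k 2 := rfl

lemma fourMom_eq (m : ℝ) (k : Mom) : fourMom m k = ![energy m ‖k‖, k 0, k 1, k 2] := by
  ext i; fin_cases i <;> rfl

lemma eta_mul_eta : eta * eta = 1 := by
  rw [eta, Matrix.diagonal_mul_diagonal, ← Matrix.diagonal_one]
  congr 1
  ext i; fin_cases i <;> norm_num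

/-- The defining relation makes `η Lᵀ η` a left inverse of `L`; for square matrices it is also a
right inverse, which is the relation for rows. -/
lemma lorentz_row {L : Matrix (Fin 4) (Fin 4) ℝ} (h : L ∈ lorentz) :
    L * eta * L.transpose = eta := by
  have h1 : (eta * L.transpose * eta) * L = 1 := by
    rw [Matrix.mul_assoc, Matrix.mul_assoc, ← Matrix.mul_assoc _ eta L, h.1, eta_mul_eta]
  have h2 := mul_eq_one_comm.1 h1
  calc L * eta * L.transpose = (L * (eta * L.transpose * eta)) * eta := by
        simp only [Matrix.mul_assoc, eta_mul_eta, Matrix.mul_one]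
    _ = eta := by rw [h2, one_mul]

lemma lorentz_col_zero {L : Matrix (Fin 4) (Fin 4) ℝ} (h : L ∈ lorentz) :
    L 0 0 ^ 2 = L 1 0 ^ 2 + L 2 0 ^ 2 + L 3 0 ^ 2 + 1 := by
  have := congrFun (congrFun h.1 0) 0
  simp [eta, Matrix.mul_apply, Fin.sum_univ_four, Matrix.diagonal] at this
  linarith

lemma lorentz_row_zero {L : Matrix (Fin 4) (Fin 4) ℝ} (h : L ∈ lorentz) :
    L 0 0 ^ 2 = L 0 1 ^ 2 + L 0 2 ^ 2 + L 0 3 ^ 2 + 1 := by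
  have := congrFun (congrFun (lorentz_row h) 0) 0
  simp [eta, Matrix.mul_apply, Fin.sum_univ_four, Matrix.diagonal] at this
  linarith

/-- Two future-directed timelike vectors have positive scalar product. -/
lemma timelike_pos {a a1 a2 a3 b b1 b2 b3 c d : ℝ} (ha : 0 < a) (hb : 0 < b) (hc : 0 < c)
    (hd : 0 < d) (h1 : a ^ 2 = a1 ^ 2 + a2 ^ 2 + a3 ^ 2 + c)
    (h2 : b ^ 2 = b1 ^ 2 + b2 ^ 2 + b3 ^ 2 + d) :
    0 < a * b + a1 * b1 + a2 * b2 + a3 * b3 := by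
  -- Cauchy–Schwarz for the spatial parts, with Lagrange's identity supplying the squares; it is
  -- strict because `c * d > 0`.
  have hcs : (a1 * b1 + a2 * b2 + a3 * b3) ^ 2 < (a * b) ^ 2 := by
    rw [mul_pow, h1, h2]
    nlinarith [sq_nonneg (a1 * b2 - a2 * b1), sq_nonneg (a1 * b3 - a3 * b1),
      sq_nonneg (a2 * b3 - a3 * b2), mul_pos hc hd,
      mul_nonneg hc.le (add_nonneg (add_nonneg (sq_nonneg b1) (sq_nonneg b2)) (sq_nonneg b3)),
      mul_nonneg hd.le (add_nonneg (add_nonneg (sq_nonneg a1) (sq_nonneg a2)) (sq_nonneg a3))]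
  have := (abs_lt.1 (abs_lt_of_sq_lt_sq hcs (mul_pos ha hb).le)).1
  linarith

lemma one_mem_lorentz : (1 : Matrix (Fin 4) (Fin 4) ℝ) ∈ lorentz := by
  simp [lorentz]

lemma lorentz_mul {L L' : Matrix (Fin 4) (Fin 4) ℝ} (h : L ∈ lorentz) (h' : L' ∈ lorentz) :
    L * L' ∈ lorentz := by
  refine ⟨?_, by rw [Matrix.det_mul, h.2.1, h'.2.1, one_mul], ?_⟩
  · rw [Matrix.transpose_mul]
    calc L'.transpose * L.transpose * eta * (L * L')
        = L'.transpose * (L.transpose * eta * L) * L' := by simp only [Matrix.mul_assoc]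
      _ = eta := by rw [h.1, h'.1]
  · rw [Matrix.mul_apply, Fin.sum_univ_four]
    exact timelike_pos h.2.2 h'.2.2 one_pos one_pos (lorentz_row_zero h) (lorentz_col_zero h')

/-- Invariance of the Minkowski square puts `Λp` on one of the two sheets of the mass hyperboloid,
and `timelike_pos` selects the positive one. The energy is therefore recovered from the spatial part
alone. -/
lemma fourMom_lorentzAct {m : ℝ} (hm : 0 < m) {L : Matrix (Fin 4) (Fin 4) ℝ} (h : L ∈ lorentz)
    (k : Mom) : fourMom m (lorentzAct m L k) = L.mulVec (fourMom m k) := by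
  set p := fourMom m k with hp
  have hpos : 0 < L.mulVec p 0 := by
    rw [Matrix.mulVec, dotProduct, Fin.sum_univ_four]
    refine timelike_pos h.2.2 (energy_pos hm ‖k‖) one_pos (pow_pos hm 2) (lorentz_row_zero h) ?_
    exact energy_sq_coords m k
  have hinv : p ⬝ᵥ (eta.mulVec p) = L.mulVec p ⬝ᵥ (eta.mulVec (L.mulVec p)) := by
    conv_lhs => rw [← h.1]
    simp only [← Matrix.mulVec_mulVec, Matrix.dotProduct_mulVec, Matrix.vecMul_transpose]
  have hsq : L.mulVec p 0 ^ 2 =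
      L.mulVec p 1 ^ 2 + L.mulVec p 2 ^ 2 + L.mulVec p 3 ^ 2 + m ^ 2 := by
    have e := energy_sq_coords m k
    generalize L.mulVec p = q at hinv
    simp [eta, Matrix.mulVec_diagonal, dotProduct, Fin.sum_univ_four, hp] at hinv
    nlinarith
  have h0 : energy m ‖lorentzAct m L k‖ = L.mulVec p 0 := by
    rw [energy, norm_sq_eq_coords]
    have : (lorentzAct m L k 0) ^ 2 + (lorentzAct m L k 1) ^ 2 + (lorentzAct m L k 2) ^ 2 + m ^ 2
      = L.mulVec p 0 ^ 2 := hsq.symm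
    rw [this, Real.sqrt_sq hpos.le]
  ext i
  refine Fin.cases ?_ (fun j => ?_) i
  · exact h0
  · rfl

lemma lorentzAct_eq_of_mulVec {m : ℝ} {L : Matrix (Fin 4) (Fin 4) ℝ} {k q : Mom}
    (h : L.mulVec (fourMom m k) = fourMom m q) : lorentzAct m L k = q := by
  ext i
  exact congrFun h i.succ

lemma lorentzAct_one (m : ℝ) (k : Mom) : lorentzAct m 1 k = k :=
  lorentzAct_eq_of_mulVec (Matrix.one_mulVec _)

lemma lorentzAct_mul {m : ℝ} (hm : 0 < m) (L : Matrix (Fin 4) (Fin 4) ℝ)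
    {L' : Matrix (Fin 4) (Fin 4) ℝ} (h' : L' ∈ lorentz)
    (k : Mom) : lorentzAct m (L * L') k = lorentzAct m L (lorentzAct m L' k) := by
  ext i
  simp only [lorentzAct, ← Matrix.mulVec_mulVec]
  rw [← fourMom_lorentzAct hm h']
  rfl

/-! ### Rotations and boosts -/

lemma rotation_mem (a : Fin 3) (t : ℝ) : rotation a t ∈ lorentz := by
  have h := Real.sin_sq_add_cos_sq t
  fin_cases a <;> refine ⟨?_, ?_, ?_⟩ <;> simp [rotation]
  all_goals first
    | (ext i j; fin_cases i <;> fin_cases j <;>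
        simp [eta, Matrix.mul_apply, Fin.sum_univ_four, Matrix.diagonal, Matrix.transpose] <;>
        first | linear_combination h | linear_combination -h | ring)
    | (simp [Matrix.det_succ_row_zero, Fin.sum_univ_succ, Fin.succAbove]; linear_combination h)

lemma boost_mem (a : Fin 3) (t : ℝ) : boost a t ∈ lorentz := by
  have h := Real.cosh_sq t
  have h0 := Real.cosh_pos t
  fin_cases a <;> refine ⟨?_, ?_, ?_⟩ <;> simp [boost, h0]
  all_goals first
    | (ext i j; fin_cases i <;> fin_cases j <;>
        simp [eta, Matrix.mul_apply, Fin.sum_univ_four, Matrix.diagonal, Matrix.transpose] <;>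
        first | linear_combination h | linear_combination -h | ring)
    | (simp [Matrix.det_succ_row_zero, Fin.sum_univ_succ, Fin.succAbove]; linear_combination h)

lemma rotation_zero (a : Fin 3) : rotation a 0 = 1 := by
  fin_cases a <;> ext i j <;> fin_cases i <;> fin_cases j <;> simp [rotation]

lemma boost_zero (a : Fin 3) : boost a 0 = 1 := by
  fin_cases a <;> ext i j <;> fin_cases i <;> fin_cases j <;> simp [boost]

lemma rotation_add (a : Fin 3) (s t : ℝ) : rotation a s * rotation a t = rotation a (s + t) := by
  fin_cases a <;> ext i j <;> fin_cases i <;> fin_cases j <;>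
    simp [rotation, Matrix.mul_apply, Fin.sum_univ_four, Real.cos_add, Real.sin_add] <;> ring

lemma boost_add (a : Fin 3) (s t : ℝ) : boost a s * boost a t = boost a (s + t) := by
  fin_cases a <;> ext i j <;> fin_cases i <;> fin_cases j <;>
    simp [boost, Matrix.mul_apply, Fin.sum_univ_four, Real.cosh_add, Real.sinh_add] <;> ring

lemma rotation_inv (a : Fin 3) (t : ℝ) : (rotation a t)⁻¹ = rotation a (-t) :=
  Matrix.inv_eq_right_inv (by rw [rotation_add, add_neg_cancel, rotation_zero])

lemma boost_inv (a : Fin 3) (t : ℝ) : (boost a t)⁻¹ = boost a (-t) :=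
  Matrix.inv_eq_right_inv (by rw [boost_add, add_neg_cancel, boost_zero])

/-! ### The rest boost -/

/-- The boost with four-velocity `(w, x, y, z) / m`. -/
def pureBoost (m w x y z : ℝ) : Matrix (Fin 4) (Fin 4) ℝ :=
  !![w / m, x / m, y / m, z / m;
    x / m, 1 + x * x / (m * (w + m)), x * y / (m * (w + m)), x * z / (m * (w + m));
    y / m, y * x / (m * (w + m)), 1 + y * y / (m * (w + m)), y * z / (m * (w + m));
    z / m, z * x / (m * (w + m)), z * y / (m * (w + m)), 1 + z * z / (m * (w + m))]

/-- The rotation-free Lorentz transformation taking the momentum `0` to `k`. -/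
def restBoost (m : ℝ) (k : Mom) : Matrix (Fin 4) (Fin 4) ℝ :=
  pureBoost m (energy m ‖k‖) (k 0) (k 1) (k 2)

lemma pureBoost_mem {m w x y z : ℝ} (hm : 0 < m) (hw : 0 < w)
    (h : w ^ 2 = x ^ 2 + y ^ 2 + z ^ 2 + m ^ 2) : pureBoost m w x y z ∈ lorentz := by
  have h1 : w + m ≠ 0 := by positivity
  have hz : z ^ 2 = w ^ 2 - m ^ 2 - x ^ 2 - y ^ 2 := by linarith
  refine ⟨?_, ?_, by simp [pureBoost]; positivity⟩
  · ext i j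
    fin_cases i <;> fin_cases j <;>
      simp [pureBoost, eta, Matrix.mul_apply, Fin.sum_univ_four, Matrix.diagonal,
        Matrix.transpose] <;> field_simp <;> grind
  · simp [pureBoost, Matrix.det_succ_row_zero, Fin.sum_univ_succ, Fin.succAbove]
    field_simp
    grind

lemma restBoost_mem {m : ℝ} (hm : 0 < m) (k : Mom) : restBoost m k ∈ lorentz :=
  pureBoost_mem hm (energy_pos hm _) (energy_sq_coords m k)

lemma pureBoost_mul_neg {m w x y z : ℝ} (hm : 0 < m) (hw : 0 < w)
    (h : w ^ 2 = x ^ 2 + y ^ 2 + z ^ 2 + m ^ 2) :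
    pureBoost m w x y z * pureBoost m w (-x) (-y) (-z) = 1 := by
  have h1 : w + m ≠ 0 := by positivity
  ext i j
  fin_cases i <;> fin_cases j <;>
    simp [pureBoost, Matrix.mul_apply, Fin.sum_univ_four] <;> field_simp <;> grind

lemma restBoost_mul_neg {m : ℝ} (hm : 0 < m) (k : Mom) : restBoost m k * restBoost m (-k) = 1 := by
  have := pureBoost_mul_neg hm (energy_pos hm ‖k‖) (energy_sq_coords m k)
  simpa only [restBoost, norm_neg, PiLp.neg_apply] using this

lemma restBoost_neg_mul {m : ℝ} (hm : 0 < m) (k : Mom) : restBoost m (-k) * restBoost m k = 1 := by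
  simpa using restBoost_mul_neg hm (-k)

lemma restBoost_mulVec {m : ℝ} (hm : 0 < m) (k : Mom) :
    (restBoost m k).mulVec (fourMom m 0) = fourMom m k := by
  ext i
  fin_cases i <;> simp [restBoost, pureBoost, Matrix.mulVec, dotProduct, Fin.sum_univ_four,
    energy_zero hm, hm.ne']

lemma lorentzAct_restBoost {m : ℝ} (hm : 0 < m) (k : Mom) :
    lorentzAct m (restBoost m k) 0 = k :=
  lorentzAct_eq_of_mulVec (restBoost_mulVec hm k)

lemma restBoost_neg_mulVec {m : ℝ} (hm : 0 < m) (k : Mom) :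
    (restBoost m (-k)).mulVec (fourMom m k) = fourMom m 0 := by
  rw [← restBoost_mulVec hm k, Matrix.mulVec_mulVec, restBoost_neg_mul hm, Matrix.one_mulVec]

lemma lorentzAct_restBoost_neg {m : ℝ} (hm : 0 < m) (k : Mom) :
    lorentzAct m (restBoost m (-k)) k = 0 :=
  lorentzAct_eq_of_mulVec (restBoost_neg_mulVec hm k)

/-! ### Rotations, boosts and the rest boost -/

/-- A boost conjugated by a rotation is the boost with rotated velocity, so the Wigner rotation of a
rotation does not depend on `k`. The identity is polynomial once `(w + m)⁻¹` is treated as a free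
symbol, so no mass-shell relation enters. -/
lemma rotation_mul_pureBoost (a : Fin 3) (t m w x y z : ℝ) :
    rotation a t * pureBoost m w x y z =
      pureBoost m w ((rotation a t).mulVec ![w, x, y, z] 1) ((rotation a t).mulVec ![w, x, y, z] 2)
        ((rotation a t).mulVec ![w, x, y, z] 3) * rotation a t := by
  have h := Real.sin_sq_add_cos_sq t
  have hs : Real.sin t ^ 2 = 1 - Real.cos t ^ 2 := by linarith
  have hs3 : Real.sin t ^ 3 = Real.sin t * (1 - Real.cos t ^ 2) := by rw [← hs]; ring
  fin_cases a <;> ext i j <;> fin_cases i <;> fin_cases j <;>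
    simp [rotation, pureBoost, Matrix.mulVec, dotProduct, Matrix.mul_apply, Fin.sum_univ_four,
      div_eq_mul_inv] <;>
    generalize (w + m)⁻¹ = u <;> ring_nf <;> simp only [hs, hs3] <;> ring

lemma energy_rotation {m : ℝ} (hm : 0 < m) (a : Fin 3) (t : ℝ) (k : Mom) :
    energy m ‖lorentzAct m (rotation a t) k‖ = energy m ‖k‖ := by
  have := congrFun (fourMom_lorentzAct hm (rotation_mem a t) k) 0
  rw [fourMom_zero] at this
  rw [this]
  fin_cases a <;> simp [rotation, Matrix.mulVec, dotProduct, Fin.sum_univ_four]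

lemma rotation_mul_restBoost {m : ℝ} (hm : 0 < m) (a : Fin 3) (t : ℝ) (k : Mom) :
    rotation a t * restBoost m k =
      restBoost m (lorentzAct m (rotation a t) k) * rotation a t := by
  rw [restBoost, rotation_mul_pureBoost, restBoost, energy_rotation hm, ← fourMom_eq]
  rfl

/-! ### Derivatives of one-parameter families of Lorentz matrices -/

/-- The unit vector along the `a`-th axis. -/
def axis (a : Fin 3) : Mom := EuclideanSpace.single a 1

/-- The infinitesimal rotation `v ↦ w × v`. -/
def rotGen (w : Mom) : Fin 4 → Fin 4 → ℝ :=
  ![![0, 0, 0, 0], ![0, 0, -w 2, w 1], ![0, w 2, 0, -w 0], ![0, -w 1, w 0, 0]]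

/-- The infinitesimal boost in the direction `w`. -/
def boostGen (w : Mom) : Fin 4 → Fin 4 → ℝ :=
  ![![0, w 0, w 1, w 2], ![w 0, 0, 0, 0], ![w 1, 0, 0, 0], ![w 2, 0, 0, 0]]

lemma rotGen_add (u v : Mom) : rotGen (u + v) = rotGen u + rotGen v := by
  ext i j; fin_cases i <;> fin_cases j <;> simp [rotGen] <;> ring

lemma rotGen_smul (c : ℝ) (u : Mom) : rotGen (c • u) = c • rotGen u := by
  ext i j; fin_cases i <;> fin_cases j <;> simp [rotGen]

lemma hasDerivAt_mul_entries {A B : ℝ → Matrix (Fin 4) (Fin 4) ℝ}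
    {A' B' : Matrix (Fin 4) (Fin 4) ℝ} {t : ℝ}
    (hA : ∀ i j, HasDerivAt (fun s => A s i j) (A' i j) t)
    (hB : ∀ i j, HasDerivAt (fun s => B s i j) (B' i j) t) (i j : Fin 4) :
    HasDerivAt (fun s => (A s * B s) i j) ((A' * B t + A t * B') i j) t := by
  simp only [Matrix.add_apply, Matrix.mul_apply, ← Finset.sum_add_distrib]
  exact HasDerivAt.fun_sum fun l _ => (hA i l).mul (hB l j)

lemma hasDerivAt_rotation_entries (a : Fin 3) (i j : Fin 4) :
    HasDerivAt (fun t => rotation a t i j) (rotGen (axis a) i j) 0 := by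
  have hc : HasDerivAt (fun t : ℝ => Real.cos t) 0 0 := by simpa using Real.hasDerivAt_cos 0
  have hs : HasDerivAt (fun t : ℝ => Real.sin t) 1 0 := by simpa using Real.hasDerivAt_sin 0
  have hs' := hs.neg
  have hk (c : ℝ) := hasDerivAt_const (0 : ℝ) c
  fin_cases a <;> fin_cases i <;> fin_cases j <;>
    simp [rotation, rotGen, axis] <;> first | exact hc | exact hs | exact hs' | exact hk _

lemma hasDerivAt_boost_entries (a : Fin 3) (i j : Fin 4) :
    HasDerivAt (fun t => boost a t i j) (boostGen (axis a) i j) 0 := by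
  have hc : HasDerivAt (fun t : ℝ => Real.cosh t) 0 0 := by simpa using Real.hasDerivAt_cosh 0
  have hs : HasDerivAt (fun t : ℝ => Real.sinh t) 1 0 := by simpa using Real.hasDerivAt_sinh 0
  have hk (c : ℝ) := hasDerivAt_const (0 : ℝ) c
  fin_cases a <;> fin_cases i <;> fin_cases j <;>
    simp [boost, boostGen, axis] <;> first | exact hc | exact hs | exact hk _

/-- The derivative of `pureBoost m w x y z` in the direction `(w', x', y', z')`. -/
def pureBoostDeriv (m w x y z w' x' y' z' : ℝ) : Matrix (Fin 4) (Fin 4) ℝ :=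
  let d (p q p' q' : ℝ) :=
    ((p' * q + p * q') * (m * (w + m)) - p * q * (m * w')) / (m * (w + m)) ^ 2
  !![w' / m, x' / m, y' / m, z' / m;
    x' / m, d x x x' x', d x y x' y', d x z x' z';
    y' / m, d y x y' x', d y y y' y', d y z y' z';
    z' / m, d z x z' x', d z y z' y', d z z z' z']

lemma hasDerivAt_pureBoost_entries {m : ℝ} {w x y z : ℝ → ℝ} {w' x' y' z' t : ℝ}
    (hw : HasDerivAt w w' t) (hx : HasDerivAt x x' t) (hy : HasDerivAt y y' t)
    (hz : HasDerivAt z z' t) (h0 : m * (w t + m) ≠ 0) (i j : Fin 4) :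
    HasDerivAt (fun s => pureBoost m (w s) (x s) (y s) (z s) i j)
      (pureBoostDeriv m (w t) (x t) (y t) (z t) w' x' y' z' i j) t := by
  have hd : HasDerivAt (fun s => m * (w s + m)) (m * w') t := (hw.add_const m).const_mul m
  fin_cases i <;> fin_cases j <;> simp [pureBoost, pureBoostDeriv] <;>
    first
    | exact hw.div_const m | exact hx.div_const m | exact hy.div_const m | exact hz.div_const m
    | exact (hx.mul hx).div hd h0 | exact (hx.mul hy).div hd h0 | exact (hx.mul hz).div hd h0
    | exact (hy.mul hx).div hd h0 | exact (hy.mul hy).div hd h0 | exact (hy.mul hz).div hd h0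
    | exact (hz.mul hx).div hd h0 | exact (hz.mul hy).div hd h0 | exact (hz.mul hz).div hd h0

lemma boost_mulVec_hasDerivAt (m : ℝ) (a : Fin 3) (k : Mom) (i : Fin 4) :
    HasDerivAt (fun t => (boost a (-t)).mulVec (fourMom m k) i)
      (-(Matrix.of (boostGen (axis a))).mulVec (fourMom m k) i) 0 := by
  have h (i j : Fin 4) : HasDerivAt (fun t => boost a (-t) i j) (-boostGen (axis a) i j) 0 := by
    have := hasDerivAt_boost_entries a i j
    rw [← neg_zero] at this
    simpa [Function.comp_def] using HasDerivAt.scomp (0 : ℝ) this (hasDerivAt_neg (0 : ℝ))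
  simp only [Matrix.mulVec, dotProduct, ← Finset.sum_neg_distrib, ← neg_mul]
  exact HasDerivAt.fun_sum fun l _ => (h i l).mul_const _

-- The infinitesimal Wigner rotation of a boost. The left side is the derivative at `0` of `Λ_a(t)
-- L_{Λ_a(-t)k}`. Since `L_k⁻¹ Λ_a(t) L_{Λ_a(-t)k}` stays in the rotation group, that derivative
-- must be `L_k` times a rotation generator; its axis is `k × e_a / (w + m)`.
set_option maxHeartbeats 1000000 in
lemma boostGen_mul_pureBoost (a : Fin 3) {m w x y z : ℝ} (hm : 0 < m) (hw : 0 < w)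
    (h : w ^ 2 = x ^ 2 + y ^ 2 + z ^ 2 + m ^ 2) :
    Matrix.of (boostGen (axis a)) * pureBoost m w x y z
      + pureBoostDeriv m w x y z
        (-(Matrix.of (boostGen (axis a))).mulVec ![w, x, y, z] 0)
        (-(Matrix.of (boostGen (axis a))).mulVec ![w, x, y, z] 1)
        (-(Matrix.of (boostGen (axis a))).mulVec ![w, x, y, z] 2)
        (-(Matrix.of (boostGen (axis a))).mulVec ![w, x, y, z] 3)
      = pureBoost m w x y z *
        Matrix.of (rotGen ((w + m)⁻¹ • cross (WithLp.toLp 2 ![x, y, z]) (axis a))) := by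
  have h1 : w + m ≠ 0 := by positivity
  fin_cases a <;> ext i j <;> fin_cases i <;> fin_cases j <;>
    simp [boostGen, rotGen, axis, cross, pureBoost, pureBoostDeriv, Matrix.mulVec, dotProduct,
      Matrix.mul_apply, Fin.sum_univ_four] <;>
    field_simp <;> grind

/-- The derivative of the Wigner rotation of an infinitesimal boost. -/
lemma hasDerivAt_wigner {m : ℝ} (hm : 0 < m) (a : Fin 3) (k : Mom) :
    HasDerivAt (fun t => Matrix.of.symm (restBoost m (-k) *
        (boost a t * restBoost m (lorentzAct m (boost a (-t)) k))))
      (rotGen ((energy m ‖k‖ + m)⁻¹ • cross k (axis a))) 0 := by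
  have hw := energy_pos hm ‖k‖
  have hd (i : Fin 4) := boost_mulVec_hasDerivAt m a k i
  have hL (i j : Fin 4) : HasDerivAt
      (fun t => restBoost m (lorentzAct m (boost a (-t)) k) i j)
      (pureBoostDeriv m (energy m ‖k‖) (k 0) (k 1) (k 2)
        (-(Matrix.of (boostGen (axis a))).mulVec (fourMom m k) 0)
        (-(Matrix.of (boostGen (axis a))).mulVec (fourMom m k) 1)
        (-(Matrix.of (boostGen (axis a))).mulVec (fourMom m k) 2)
        (-(Matrix.of (boostGen (axis a))).mulVec (fourMom m k) 3) i j) 0 := by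
    -- The energy along the curve is the time component of the boosted four-vector, so all arguments
    -- of `pureBoost` are components of one explicitly differentiable curve.
    have e (t : ℝ) : energy m ‖lorentzAct m (boost a (-t)) k‖
        = (boost a (-t)).mulVec (fourMom m k) 0 := by
      rw [← fourMom_lorentzAct hm (boost_mem a _)]; rfl
    have h0 : (boost a (-0)).mulVec (fourMom m k) = fourMom m k := by
      rw [neg_zero, boost_zero, Matrix.one_mulVec]
    have := hasDerivAt_pureBoost_entries (m := m) (hd 0) (hd 1) (hd 2) (hd 3)
      (by rw [h0, fourMom_zero]; positivity) i j
    simp only [h0, fourMom_zero, fourMom_one, fourMom_two, fourMom_three] at this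
    simp only [restBoost, e]
    exact this
  have hBL := hasDerivAt_mul_entries (hasDerivAt_boost_entries a) hL
  have hC (i j : Fin 4) := hasDerivAt_const (0 : ℝ) (restBoost m (-k) i j)
  have hW := hasDerivAt_mul_entries (A' := 0) (B' := Matrix.of (boostGen (axis a)) * restBoost m k +
    pureBoostDeriv m (energy m ‖k‖) (k 0) (k 1) (k 2)
        (-(Matrix.of (boostGen (axis a))).mulVec (fourMom m k) 0)
        (-(Matrix.of (boostGen (axis a))).mulVec (fourMom m k) 1)
        (-(Matrix.of (boostGen (axis a))).mulVec (fourMom m k) 2)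
        (-(Matrix.of (boostGen (axis a))).mulVec (fourMom m k) 3)) hC (fun i j => by
      have := hBL i j
      simp only [neg_zero, boost_zero, lorentzAct_one, one_mul] at this
      exact this)
  rw [hasDerivAt_pi]; intro i
  rw [hasDerivAt_pi]; intro j
  refine (hW i j).congr_deriv ?_
  have hk : (WithLp.toLp 2 ![k 0, k 1, k 2] : Mom) = k := by
    ext i; fin_cases i <;> rfl
  rw [zero_mul, zero_add, fourMom_eq, restBoost, restBoost,
    boostGen_mul_pureBoost a hm hw (energy_sq_coords m k), hk, ← Matrix.mul_assoc]
  have := restBoost_neg_mul hm k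
  rw [restBoost, restBoost] at this
  rw [this, one_mul]
  rfl

lemma hasDerivAt_rotation (a : Fin 3) :
    HasDerivAt (fun t => Matrix.of.symm (rotation a t)) (rotGen (axis a)) 0 :=
  hasDerivAt_pi.2 fun i => hasDerivAt_pi.2 fun j => hasDerivAt_rotation_entries a i j

/-! ### The stabilizer of the rest momentum -/

lemma exists_polar (x y : ℝ) : ∃ r t : ℝ, 0 ≤ r ∧ x = r * Real.cos t ∧ y = r * Real.sin t :=
  ⟨‖(⟨x, y⟩ : ℂ)‖, Complex.arg ⟨x, y⟩, norm_nonneg _, (Complex.norm_mul_cos_arg ⟨x, y⟩).symm,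
    (Complex.norm_mul_sin_arg ⟨x, y⟩).symm⟩

lemma exists_angle {x y : ℝ} (h : x ^ 2 + y ^ 2 = 1) : ∃ t, x = Real.cos t ∧ y = Real.sin t := by
  obtain ⟨r, t, hr, hx, hy⟩ := exists_polar x y
  have hr2 : r ^ 2 = 1 := by
    have := Real.sin_sq_add_cos_sq t
    rw [hx, hy] at h
    linear_combination h - r ^ 2 * this
  have hr1 : r = 1 := by nlinarith
  exact ⟨t, by simpa [hr1] using hx, by simpa [hr1] using hy⟩

/-- The metric relation clears the remaining entries of the first and last rows and leaves a planar
block that is orthogonal of determinant one. -/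
lemma exists_eq_rotation_two {W : Matrix (Fin 4) (Fin 4) ℝ} (hW : W ∈ lorentz)
    (h0 : ∀ i, W i 0 = ![1, 0, 0, 0] i)
    (h3 : ∀ i, W i 3 = ![0, 0, 0, 1] i) : ∃ t, W = rotation 2 t := by
  have col (i j : Fin 4) := congrFun (congrFun hW.1 i) j
  have r01 := col 0 1
  have r02 := col 0 2
  have r31 := col 3 1
  have r32 := col 3 2
  have r11 := col 1 1
  have r12 := col 1 2
  have hdet := hW.2.1
  have a0 : W 0 0 = 1 := h0 0
  have a1 : W 1 0 = 0 := h0 1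
  have a2 : W 2 0 = 0 := h0 2
  have a3 : W 3 0 = 0 := h0 3
  have b0 : W 0 3 = 0 := h3 0
  have b1 : W 1 3 = 0 := h3 1
  have b2 : W 2 3 = 0 := h3 2
  have b3 : W 3 3 = 1 := h3 3
  simp [eta, Matrix.mul_apply, Fin.sum_univ_four, Matrix.diagonal, a0, a1, a2, a3] at r01 r02
  simp [eta, Matrix.mul_apply, Fin.sum_univ_four, Matrix.diagonal, b0, b1, b2, b3] at r31 r32
  simp [eta, Matrix.mul_apply, Fin.sum_univ_four, Matrix.diagonal, r01, r02, r31, r32] at r11 r12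
  simp [Matrix.det_succ_row_zero, Fin.sum_univ_succ, Fin.succAbove, a0, a1, a2, a3, b1, b2, b3,
    r31, r32] at hdet
  obtain ⟨t, hx, hy⟩ := exists_angle (x := W 1 1) (y := W 2 1) (by linarith)
  have h := Real.sin_sq_add_cos_sq t
  rw [hx, hy] at r12 hdet
  -- The determinant and the orthogonality of the two columns form a linear system for the second
  -- column, solved with `sin² + cos² = 1`.
  have h22 : W 2 2 = Real.cos t := by
    linear_combination Real.cos t * hdet - Real.sin t * r12 - W 2 2 * h
  have h12 : W 1 2 = -Real.sin t := by
    linear_combination -Real.sin t * hdet - Real.cos t * r12 - W 1 2 * h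
  refine ⟨t, ?_⟩
  ext i j
  fin_cases i <;> fin_cases j <;>
    simp [rotation, a0, a1, a2, a3, b0, b1, b2, b3, r01, r02, r31, r32, hx, hy, h12, h22]

/-- Euler angles. -/
lemma exists_euler {W : Matrix (Fin 4) (Fin 4) ℝ} (hW : W ∈ lorentz)
    (h0 : ∀ i, W i 0 = ![1, 0, 0, 0] i) :
    ∃ a b c, W = rotation 2 a * (rotation 1 b * rotation 2 c) := by
  have a0 : W 0 0 = 1 := h0 0
  have a1 : W 1 0 = 0 := h0 1
  have a2 : W 2 0 = 0 := h0 2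
  have a3 : W 3 0 = 0 := h0 3
  have r03 := congrFun (congrFun hW.1 0) 3
  have r33 := congrFun (congrFun hW.1 3) 3
  simp [eta, Matrix.mul_apply, Fin.sum_univ_four, Matrix.diagonal, a0, a1, a2, a3] at r03
  simp [eta, Matrix.mul_apply, Fin.sum_univ_four, Matrix.diagonal, r03] at r33
  -- The image of the third axis in spherical coordinates: `a` is its azimuth and `b` its polar
  -- angle. Undoing both leaves a rotation that fixes the third axis.
  obtain ⟨r, a, -, hx, hy⟩ := exists_polar (W 1 3) (W 2 3)
  have ha := Real.sin_sq_add_cos_sq a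
  obtain ⟨b, hb3, hbr⟩ := exists_angle (x := W 3 3) (y := r) (by
    rw [hx, hy] at r33; linear_combination -r33 - r ^ 2 * ha)
  have hb := Real.sin_sq_add_cos_sq b
  subst hbr
  have hmem : rotation 1 (-b) * (rotation 2 (-a) * W) ∈ lorentz :=
    lorentz_mul (rotation_mem _ _) (lorentz_mul (rotation_mem _ _) hW)
  obtain ⟨c, hc⟩ := exists_eq_rotation_two hmem
    (fun i => by
      fin_cases i <;>
        simp [rotation, Matrix.mul_apply, Matrix.vecMul, dotProduct, Fin.sum_univ_four,
          a0, a1, a2, a3])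
    (fun i => by
      fin_cases i <;>
        simp [rotation, Matrix.mul_apply, Matrix.vecMul, dotProduct, Fin.sum_univ_four,
          r03, hx, hy, hb3] <;> grind)
  refine ⟨a, b, c, ?_⟩
  rw [← hc, ← Matrix.mul_assoc (rotation 1 b), rotation_add, add_neg_cancel, rotation_zero, one_mul,
    ← Matrix.mul_assoc, rotation_add, add_neg_cancel, rotation_zero, one_mul]

/-! ### Calculus of `ℂ`-linear maps depending on a real parameter -/

section Calculus

variable {V : Type*} [NormedAddCommGroup V] [InnerProductSpace ℂ V]
  {F : Type*} [NormedAddCommGroup F] [NormedSpace ℝ F]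

lemma contDiffOn_apply {A : F → V →L[ℂ] V} {ψ : F → V} {U : Set F}
    (hA : ContDiffOn ℝ ∞ A U) (hψ : ContDiffOn ℝ ∞ ψ U) :
    ContDiffOn ℝ ∞ (fun k => A k (ψ k)) U :=
  ((ContinuousLinearMap.restrictScalarsL ℂ V V ℝ ℝ).contDiff.comp_contDiffOn hA).clm_apply hψ

lemma hasFDerivAt_apply {A : F → V →L[ℂ] V} {ψ : F → V} {k : F}
    (hA : DifferentiableAt ℝ A k) (hψ : DifferentiableAt ℝ ψ k) (x : F) :
    DifferentiableAt ℝ (fun q => A q (ψ q)) k ∧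
    fderiv ℝ (fun q => A q (ψ q)) k x = fderiv ℝ A k x (ψ k) + A k (fderiv ℝ ψ k x) := by
  have h := (((ContinuousLinearMap.restrictScalarsL ℂ V V ℝ ℝ).hasFDerivAt.comp k
    hA.hasFDerivAt).clm_apply hψ.hasFDerivAt)
  refine ⟨h.differentiableAt, ?_⟩
  have := congrArg (fun L => L x) h.fderiv
  refine this.trans ?_
  simp [add_comm]

lemma hasDerivAt_apply {A : ℝ → V →L[ℂ] V} {ψ : ℝ → V} {A' : V →L[ℂ] V} {ψ' : V} {t : ℝ}
    (hA : HasDerivAt A A' t) (hψ : HasDerivAt ψ ψ' t) :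
    HasDerivAt (fun s => A s (ψ s)) (A' (ψ t) + A t ψ') t :=
  ((ContinuousLinearMap.restrictScalarsL ℂ V V ℝ ℝ).hasFDerivAt.comp_hasDerivAt t hA).clm_apply hψ

end Calculus

/-- `rotGen` as a linear map. -/
def rotGenL : Mom →L[ℝ] (Fin 4 → Fin 4 → ℝ) :=
  LinearMap.toContinuousLinearMap
    { toFun := rotGen, map_add' := rotGen_add, map_smul' := rotGen_smul }

/-! ### Smoothness of the rest boost and the velocity fields of rotations and boosts on momenta -/

lemma energy_contDiff {m : ℝ} (hm : 0 < m) : ContDiff ℝ ∞ fun k : Mom => energy m ‖k‖ := by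
  unfold energy
  exact ContDiff.sqrt ((contDiff_norm_sq ℝ).add contDiff_const) fun k => by positivity

lemma restBoost_contDiff {m : ℝ} (hm : 0 < m) :
    ContDiff ℝ ∞ fun k : Mom => Matrix.of.symm (restBoost m k) := by
  have hw := energy_contDiff hm
  have hc (i : Fin 3) : ContDiff ℝ ∞ fun k : Mom => k i := by fun_prop
  have hd : ContDiff ℝ ∞ fun k : Mom => m * (energy m ‖k‖ + m) :=
    contDiff_const.mul (hw.add contDiff_const)
  have h0 (k : Mom) : m * (energy m ‖k‖ + m) ≠ 0 := by
    have := energy_pos hm ‖k‖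
    positivity
  have hq (i j : Fin 3) : ContDiff ℝ ∞ fun k : Mom => k i * k j / (m * (energy m ‖k‖ + m)) :=
    ((hc i).mul (hc j)).div hd h0
  have hq1 (i j : Fin 3) : ContDiff ℝ ∞ fun k : Mom => 1 + k i * k j / (m * (energy m ‖k‖ + m)) :=
    contDiff_const.add (hq i j)
  rw [contDiff_pi]; intro i
  rw [contDiff_pi]; intro j
  fin_cases i <;> fin_cases j <;>
    first
    | exact hw.div_const m
    | exact (hc _).div_const m
    | exact hq _ _
    | exact hq1 _ _

lemma hasDerivAt_lorentzAct_rotation (m : ℝ) (a : Fin 3) (k : Mom) :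
    HasDerivAt (fun t => lorentzAct m (rotation a (-t)) k) (-cross (axis a) k) 0 := by
  have h (i j : Fin 4) : HasDerivAt (fun t => rotation a (-t) i j) (-rotGen (axis a) i j) 0 := by
    have := hasDerivAt_rotation_entries a i j
    rw [← neg_zero] at this
    simpa [Function.comp_def] using HasDerivAt.scomp (0 : ℝ) this (hasDerivAt_neg (0 : ℝ))
  rw [← hasDerivWithinAt_univ, hasDerivWithinAt_iff_hasFDerivWithinAt, hasFDerivWithinAt_euclidean]
  intro i
  rw [hasFDerivWithinAt_univ]
  have := HasDerivAt.fun_sum (u := Finset.univ) fun l _ => (h i.succ l).mul_const (fourMom m k l)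
  refine (hasDerivAt_iff_hasFDerivAt.1 this).congr_fderiv ?_
  ext
  fin_cases a <;> fin_cases i <;> simp [Fin.sum_univ_four, rotGen, cross, axis]

lemma hasDerivAt_lorentzAct_boost (m : ℝ) (a : Fin 3) (k : Mom) :
    HasDerivAt (fun t => lorentzAct m (boost a (-t)) k) (-energy m ‖k‖ • axis a) 0 := by
  rw [← hasDerivWithinAt_univ, hasDerivWithinAt_iff_hasFDerivWithinAt, hasFDerivWithinAt_euclidean]
  intro i
  rw [hasFDerivWithinAt_univ]
  refine (hasDerivAt_iff_hasFDerivAt.1 (boost_mulVec_hasDerivAt m a k i.succ)).congr_fderiv ?_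
  ext
  fin_cases a <;> fin_cases i <;>
    simp [Fin.sum_univ_four, boostGen, axis, Matrix.mulVec, dotProduct]

namespace Bundle

variable {m : ℝ} {V : Type*} [NormedAddCommGroup V] [InnerProductSpace ℂ V] (E : Bundle m V)

/-! ### The gauge defined by the rest boosts -/

/-- The action of Lorentz matrices on the fibre over the rest momentum. -/
def little (M : Fin 4 → Fin 4 → ℝ) : V →L[ℂ] V := E.act (Matrix.of M) 0 0

/-- The identification of the fibre over `0` with the fibre over `k` by the rest boost. -/
def gauge (k : Mom) : V →L[ℂ] V := E.act (restBoost m k) 0 0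

/-- The inverse of `gauge`. -/
def gaugeInv (k : Mom) : V →L[ℂ] V := E.act (restBoost m (-k)) 0 k

lemma act_mul_apply {L L' : Matrix (Fin 4) (Fin 4) ℝ} (hL : L ∈ lorentz) (hL' : L' ∈ lorentz)
    (k : Mom) (v : V) : E.act (L * L') 0 k v = E.act L 0 (lorentzAct m L' k) (E.act L' 0 k v) := by
  have := E.act_mul L hL L' hL' 0 0 k
  rw [Matrix.mulVec_zero, add_zero] at this
  rw [this]; rfl

/-- `(Λ, b)` is `(Λ, 0)` followed by a translation, and translations are scalars on each fibre.
Hence invariance of a family of subspaces need only be tested at `b = 0`. -/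
lemma act_eq_smul {L : Matrix (Fin 4) (Fin 4) ℝ} (hL : L ∈ lorentz) (b : Fin 4 → ℝ) (k : Mom)
    (v : V) : ∃ c : ℂ, E.act L b k v = c • E.act L 0 k v := by
  have := E.act_mul 1 one_mem_lorentz L hL b 0 k
  rw [Matrix.mulVec_zero, zero_add, one_mul, E.act_translation] at this
  exact ⟨_, by rw [this]; rfl⟩

variable (hm : 0 < m)
include hm

lemma gaugeInv_gauge (k : Mom) (v : V) : E.gaugeInv k (E.gauge k v) = v := by
  have := E.act_mul_apply (restBoost_mem hm (-k)) (restBoost_mem hm k) 0 v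
  rw [restBoost_neg_mul hm, E.act_one, lorentzAct_restBoost hm] at this
  exact this.symm

lemma gauge_gaugeInv (k : Mom) (v : V) : E.gauge k (E.gaugeInv k v) = v := by
  have := E.act_mul_apply (restBoost_mem hm k) (restBoost_mem hm (-k)) k v
  rw [restBoost_mul_neg hm, E.act_one, lorentzAct_restBoost_neg hm] at this
  exact this.symm

/-- Wigner's construction: in the gauge, `Λ` acts through `L_{Λk}⁻¹ Λ L_k`, which fixes the rest
momentum. -/
lemma act_gauge {L : Matrix (Fin 4) (Fin 4) ℝ} (hL : L ∈ lorentz) (k : Mom) (v : V) :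
    E.act L 0 k (E.gauge k v) = E.gauge (lorentzAct m L k)
      (E.little (Matrix.of.symm (restBoost m (-lorentzAct m L k) * (L * restBoost m k))) v) := by
  have hLr := lorentz_mul hL (restBoost_mem hm k)
  have hk : lorentzAct m (L * restBoost m k) 0 = lorentzAct m L k := by
    rw [lorentzAct_mul hm _ (restBoost_mem hm k), lorentzAct_restBoost hm]
  rw [little, Equiv.apply_symm_apply, E.act_mul_apply (restBoost_mem hm _) hLr, hk]
  change _ = E.gauge _ (E.gaugeInv _ _)
  rw [E.gauge_gaugeInv hm, E.act_mul_apply hL (restBoost_mem hm k), lorentzAct_restBoost hm]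
  rfl

lemma norm_gauge (k : Mom) (v : V) : ‖E.gauge k v‖ = ‖v‖ := by
  have := E.act_unitary _ (restBoost_mem hm k) 0 0 v v
  rw [inner_self_eq_norm_sq_to_K, inner_self_eq_norm_sq_to_K] at this
  have h2 : ‖E.gauge k v‖ ^ 2 = ‖v‖ ^ 2 := by exact_mod_cast this
  exact (sq_eq_sq₀ (norm_nonneg _) (norm_nonneg _)).1 h2

lemma gauge_contDiff : ContDiff ℝ ∞ E.gauge := by
  rw [← contDiffOn_univ]
  exact E.act_smooth.comp (t := {p | Matrix.of p.1 ∈ lorentz})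
    (f := fun k : Mom => (Matrix.of.symm (restBoost m k), (0 : Fin 4 → ℝ), (0 : Mom)))
    ((restBoost_contDiff hm).prodMk contDiff_const).contDiffOn
    fun k _ => restBoost_mem hm k

lemma gaugeInv_contDiff : ContDiff ℝ ∞ E.gaugeInv := by
  rw [← contDiffOn_univ]
  exact E.act_smooth.comp (t := {p | Matrix.of p.1 ∈ lorentz})
    (f := fun k : Mom => (Matrix.of.symm (restBoost m (-k)), (0 : Fin 4 → ℝ), k))
    (((restBoost_contDiff hm).comp contDiff_neg).prodMk
      (contDiff_const.prodMk contDiff_id)).contDiffOn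
    fun k _ => restBoost_mem hm (-k)

omit hm

/-- The derivative of the representation of the little group at the identity. -/
def littleDeriv : (Fin 4 → Fin 4 → ℝ) →L[ℝ] (V →L[ℂ] V) :=
  fderivWithin ℝ E.little {M | Matrix.of M ∈ lorentz} (Matrix.of.symm 1)

/-- The (anti-Hermitian) spin operator for the infinitesimal rotation `v ↦ w × v`. -/
def spin : Mom →L[ℝ] (V →L[ℂ] V) := E.littleDeriv.comp rotGenL

lemma little_contDiffOn : ContDiffOn ℝ ∞ E.little {M | Matrix.of M ∈ lorentz} := by
  have hf : ContDiff ℝ ∞ fun M : Fin 4 → Fin 4 → ℝ => (M, (0 : Fin 4 → ℝ), (0 : Mom)) :=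
    contDiff_id.prodMk contDiff_const
  have hmaps : Set.MapsTo (fun M : Fin 4 → Fin 4 → ℝ => (M, (0 : Fin 4 → ℝ), (0 : Mom)))
      {M | Matrix.of M ∈ lorentz} {p | Matrix.of p.1 ∈ lorentz} := by
    intro M hM
    rw [Set.mem_ofPred_eq] at hM ⊢
    exact hM
  have h := E.act_smooth.comp hf.contDiffOn hmaps
  rw [show E.little = fun M => E.act (Matrix.of M) 0 0 from rfl]
  exact h

lemma little_hasFDerivWithinAt : HasFDerivWithinAt E.little E.littleDeriv {M | Matrix.of M ∈ lorentz}
      (Matrix.of.symm 1) := by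
  have h1 : Matrix.of.symm 1 ∈ {M | Matrix.of M ∈ lorentz} := one_mem_lorentz
  exact ((E.little_contDiffOn.differentiableOn (by simp)) _ h1).hasFDerivWithinAt

/-- The Lorentz matrices do not form an open set, so `littleDeriv` is only some derivative within
that set. Along curves that stay in the group the chain rule still applies, and only such tangent
directions are used. -/
lemma hasDerivAt_little {c : ℝ → Matrix (Fin 4) (Fin 4) ℝ} {w : Mom}
    (hc : ∀ t, c t ∈ lorentz) (h0 : c 0 = 1)
    (h : HasDerivAt (fun t => Matrix.of.symm (c t)) (rotGen w) 0) :
    HasDerivAt (fun t => E.little (Matrix.of.symm (c t))) (E.spin w) 0 := by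
  have hmaps : Set.MapsTo (fun t => Matrix.of.symm (c t)) Set.univ {M | Matrix.of M ∈ lorentz} :=
    fun t _ => hc t
  have hd := E.little_hasFDerivWithinAt
  rw [← h0] at hd
  have hw : E.spin w = E.littleDeriv (rotGen w) := rfl
  rw [hw, ← hasDerivWithinAt_univ]
  rw [← hasDerivWithinAt_univ] at h
  exact HasFDerivWithinAt.comp_hasDerivWithinAt (l := E.little)
    (f := fun t => Matrix.of.symm (c t)) (0 : ℝ) hd h hmaps

lemma hasDerivAt_little_rotation (a : Fin 3) :
    HasDerivAt (fun t => E.little (Matrix.of.symm (rotation a t))) (E.spin (axis a)) 0 :=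
  E.hasDerivAt_little (rotation_mem a) (rotation_zero a) (hasDerivAt_rotation a)

lemma little_one : E.little (Matrix.of.symm 1) = ContinuousLinearMap.id ℂ V := E.act_one 0

include hm

lemma rep_eq {L L' : Matrix (Fin 4) (Fin 4) ℝ} (hL : L ∈ lorentz) (hL' : L' ∈ lorentz)
    (h : L⁻¹ = L') (h1 : L * L' = 1) (ψ : Mom → V) (k : Mom) :
    E.rep L 0 ψ k = E.gauge k (E.little (Matrix.of.symm
      (restBoost m (-k) * (L * restBoost m (lorentzAct m L' k))))
      (E.gaugeInv (lorentzAct m L' k) (ψ (lorentzAct m L' k)))) := by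
  have hk : lorentzAct m L (lorentzAct m L' k) = k := by
    rw [← lorentzAct_mul hm _ hL', h1, lorentzAct_one]
  rw [rep, h, ← E.gauge_gaugeInv hm (lorentzAct m L' k) (ψ (lorentzAct m L' k)),
    E.act_gauge hm hL, hk, E.gaugeInv_gauge hm]

lemma rep_rotation (a : Fin 3) (t : ℝ) (ψ : Mom → V) (k : Mom) :
    E.rep (rotation a t) 0 ψ k = E.gauge k (E.little (Matrix.of.symm (rotation a t))
      (E.gaugeInv (lorentzAct m (rotation a (-t)) k) (ψ (lorentzAct m (rotation a (-t)) k)))) := by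
  have h1 : rotation a t * rotation a (-t) = 1 := by
    rw [rotation_add, add_neg_cancel, rotation_zero]
  rw [E.rep_eq hm (rotation_mem a t) (rotation_mem a (-t)) (rotation_inv a t) h1,
    rotation_mul_restBoost hm, ← lorentzAct_mul hm _ (rotation_mem _ _), h1, lorentzAct_one,
    ← Matrix.mul_assoc, restBoost_neg_mul hm, one_mul]

variable {ψ : Mom → V} {k : Mom} (hψ : DifferentiableAt ℝ ψ k)
include hψ

lemma differentiableAt_gaugeInv :
    DifferentiableAt ℝ (fun q => E.gaugeInv q (ψ q)) k :=
  (hasFDerivAt_apply ((E.gaugeInv_contDiff hm).contDiffAt.differentiableAt (by simp)) hψ 0).1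

/-- The product rule splits the derivative into a spin part, from the little group, and an orbital
part, from the motion of the base point, whose velocity is `-e_a × k`. -/
lemma J_eq (a : Fin 3) : E.J a ψ k = Complex.I • E.gauge k (E.spin (axis a) (E.gaugeInv k (ψ k))
    - fderiv ℝ (fun q => E.gaugeInv q (ψ q)) k (cross (axis a) k)) := by
  have hφ := (E.differentiableAt_gaugeInv hm hψ).hasFDerivAt
  have h0 : lorentzAct m (rotation a (-0)) k = k := by
    rw [neg_zero, rotation_zero, lorentzAct_one]
  rw [← h0] at hφ
  have h1 := hφ.comp_hasDerivAt (0 : ℝ) (hasDerivAt_lorentzAct_rotation m a k)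
  have h2 := hasDerivAt_apply (hasDerivAt_const (0 : ℝ) (E.gauge k))
    (hasDerivAt_apply (E.hasDerivAt_little_rotation a) h1)
  rw [J]
  congr 1
  refine (HasDerivAt.deriv ?_)
  simp only [E.rep_rotation hm]
  refine h2.congr_deriv ?_
  simp [rotation_zero, little_one, sub_eq_add_neg, lorentzAct_one]

/-- As for `J_eq`, with the Wigner rotation now depending on `k` and with base-point velocity `-ω
e_a`. -/
lemma K_eq (a : Fin 3) : E.K a ψ k = -(Complex.I • E.gauge k
    (E.spin ((energy m ‖k‖ + m)⁻¹ • cross k (axis a)) (E.gaugeInv k (ψ k))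
    - energy m ‖k‖ • fderiv ℝ (fun q => E.gaugeInv q (ψ q)) k (axis a))) := by
  have hφ := (E.differentiableAt_gaugeInv hm hψ).hasFDerivAt
  have h0 : lorentzAct m (boost a (-0)) k = k := by
    rw [neg_zero, boost_zero, lorentzAct_one]
  rw [← h0] at hφ
  have h1 := hφ.comp_hasDerivAt (0 : ℝ) (hasDerivAt_lorentzAct_boost m a k)
  have hr (t : ℝ) := E.rep_eq hm (boost_mem a t) (boost_mem a (-t)) (boost_inv a t)
    (by rw [boost_add, add_neg_cancel, boost_zero]) ψ k
  have hw := hasDerivAt_wigner hm a k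
  have hone : restBoost m (-k) * (boost a 0 * restBoost m (lorentzAct m (boost a (-0)) k)) = 1 := by
    rw [h0, boost_zero, one_mul, restBoost_neg_mul hm]
  have hmem (t : ℝ) := lorentz_mul (restBoost_mem hm (-k))
      (lorentz_mul (boost_mem a t) (restBoost_mem hm (lorentzAct m (boost a (-t)) k)))
  generalize hc : (fun t => restBoost m (-k) * (boost a t *
    restBoost m (lorentzAct m (boost a (-t)) k))) = c
  have hct (t : ℝ) : restBoost m (-k) * (boost a t *
    restBoost m (lorentzAct m (boost a (-t)) k)) = c t := congrFun hc t
  simp only [hct] at hr hw hone hmem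
  have h2 := hasDerivAt_apply (hasDerivAt_const (0 : ℝ) (E.gauge k))
    (hasDerivAt_apply (E.hasDerivAt_little hmem hone hw) h1)
  rw [K]
  congr 2
  refine (HasDerivAt.deriv ?_)
  simp only [hr]
  refine h2.congr_deriv ?_
  rw [hone, little_one]
  simp [boost_zero, sub_eq_add_neg, lorentzAct_one]

end Bundle

/-! ### Conjugation of rotation generators, and the fixed rest momentum -/

lemma rotation_conj_rotGen (m : ℝ) (a : Fin 3) (t : ℝ) (v : Mom) :
    rotation a t * (Matrix.of (rotGen v) * rotation a (-t))
      = Matrix.of (rotGen (lorentzAct m (rotation a t) v)) := by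
  have h := Real.sin_sq_add_cos_sq t
  have hs : Real.sin t ^ 2 = 1 - Real.cos t ^ 2 := by linarith
  fin_cases a <;> ext i j <;> fin_cases i <;> fin_cases j <;>
    simp [rotation, rotGen, lorentzAct, Matrix.mulVec, dotProduct, Matrix.mul_apply,
      Fin.sum_univ_four] <;>
    ring_nf <;> simp only [hs] <;> ring

lemma lorentzAct_rotation_zero (m : ℝ) (a : Fin 3) (t : ℝ) :
    lorentzAct m (rotation a t) 0 = 0 := by
  fin_cases a <;> ext i <;> fin_cases i <;>
    simp [lorentzAct, rotation, Matrix.mulVec, dotProduct, Fin.sum_univ_four]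

lemma lorentzAct_rotation_mul_zero (m : ℝ) (a b : Fin 3) (s t : ℝ) :
    lorentzAct m (rotation a s * rotation b t) 0 = 0 := by
  have h : (rotation b t).mulVec (fourMom m 0) = fourMom m 0 := by
    fin_cases b <;> ext i <;> fin_cases i <;>
      simp [rotation, Matrix.mulVec, dotProduct, Fin.sum_univ_four]
  rw [lorentzAct, ← Matrix.mulVec_mulVec, h]
  exact lorentzAct_rotation_zero m a s

lemma coords_eq (u : Mom) : u = u 0 • axis 0 + u 1 • axis 1 + u 2 • axis 2 := by
  ext i; fin_cases i <;> simp [axis]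

namespace Bundle

variable {m : ℝ} {V : Type*} [NormedAddCommGroup V] [InnerProductSpace ℂ V] (E : Bundle m V)

/-! ### The spin operators -/

lemma little_mul {L L' : Matrix (Fin 4) (Fin 4) ℝ} (hL : L ∈ lorentz) (hL' : L' ∈ lorentz)
    (h0 : lorentzAct m L' 0 = 0) (v : V) : E.little (Matrix.of.symm (L * L')) v =
      E.little (Matrix.of.symm L) (E.little (Matrix.of.symm L') v) := by
  have := E.act_mul_apply hL hL' 0 v
  rw [h0] at this
  exact this

/-- Both sides are the derivative at `t = 0` of the action of `R_a(-s) R_b(t) R_a(s)`, computed once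
factor by factor and once as a single curve with rotated generator. -/
lemma little_rotation_conj_spin (a b : Fin 3) (s : ℝ) (x : V) :
    E.little (Matrix.of.symm (rotation a (-s)))
      (E.spin (axis b) (E.little (Matrix.of.symm (rotation a s)) x))
      = E.spin (lorentzAct m (rotation a (-s)) (axis b)) x := by
  have hmem (t : ℝ) : rotation a (-s) * (rotation b t * rotation a s) ∈ lorentz :=
    lorentz_mul (rotation_mem _ _) (lorentz_mul (rotation_mem _ _) (rotation_mem _ _))
  have hone : rotation a (-s) * (rotation b 0 * rotation a s) = 1 := by
    rw [rotation_zero, one_mul, rotation_add, neg_add_cancel, rotation_zero]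
  have hd : HasDerivAt
      (fun t => Matrix.of.symm (rotation a (-s) * (rotation b t * rotation a s)))
      (rotGen (lorentzAct m (rotation a (-s)) (axis b))) 0 := by
    refine hasDerivAt_pi.2 fun i => hasDerivAt_pi.2 fun j => ?_
    have h1 := hasDerivAt_mul_entries (A' := 0)
      (fun i j => hasDerivAt_const (0 : ℝ) (rotation a (-s) i j))
      (hasDerivAt_mul_entries (B' := 0) (hasDerivAt_rotation_entries b)
        (fun i j => hasDerivAt_const (0 : ℝ) (rotation a s i j))) i j
    refine h1.congr_deriv ?_
    have h2 := rotation_conj_rotGen m a (-s) (axis b)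
    rw [neg_neg] at h2
    rw [zero_mul, zero_add, mul_zero, add_zero]
    exact congrFun (congrFun h2 i) j
  have h1 := hasDerivAt_apply (E.hasDerivAt_little hmem hone hd) (hasDerivAt_const (0 : ℝ) x)
  have h2 := hasDerivAt_apply
    (hasDerivAt_const (0 : ℝ) (E.little (Matrix.of.symm (rotation a (-s)))))
    (hasDerivAt_apply (E.hasDerivAt_little_rotation b)
      (hasDerivAt_const (0 : ℝ) (E.little (Matrix.of.symm (rotation a s)) x)))
  have e (t : ℝ) : E.little (Matrix.of.symm (rotation a (-s) * (rotation b t * rotation a s))) x =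
      E.little (Matrix.of.symm (rotation a (-s))) (E.little (Matrix.of.symm (rotation b t))
        (E.little (Matrix.of.symm (rotation a s)) x)) := by
    rw [E.little_mul (rotation_mem _ _) (lorentz_mul (rotation_mem _ _) (rotation_mem _ _)),
      E.little_mul (rotation_mem _ _) (rotation_mem _ _) (lorentzAct_rotation_zero _ _ _)]
    exact lorentzAct_rotation_mul_zero _ _ _ _ _
  simp only [e] at h1
  have := h2.unique h1
  simpa using this

/-- Differentiate `little_rotation_conj_spin` in `s` at `0`: the left side gives the negative of the
commutator, the right side the velocity `-e_a × e_b` of the rotated axis. -/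
lemma spin_commutator_axis (a b : Fin 3) (x : V) :
    E.spin (axis a) (E.spin (axis b) x) - E.spin (axis b) (E.spin (axis a) x)
      = E.spin (cross (axis a) (axis b)) x := by
  have hd := E.hasDerivAt_little_rotation a
  have hd' : HasDerivAt (fun t => E.little (Matrix.of.symm (rotation a (-t))))
      (-E.spin (axis a)) 0 := by
    have := hd
    rw [← neg_zero] at this
    simpa [Function.comp_def] using HasDerivAt.scomp (0 : ℝ) this (hasDerivAt_neg (0 : ℝ))
  have h1 := hasDerivAt_apply hd' (hasDerivAt_apply (hasDerivAt_const (0 : ℝ) (E.spin (axis b)))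
    (hasDerivAt_apply hd (hasDerivAt_const (0 : ℝ) x)))
  have h2 := hasDerivAt_apply (E.spin.hasFDerivAt.comp_hasDerivAt (0 : ℝ)
    (hasDerivAt_lorentzAct_rotation m a (axis b))) (hasDerivAt_const (0 : ℝ) x)
  simp only [E.little_rotation_conj_spin] at h1
  have := h1.unique h2
  simp [rotation_zero, little_one] at this
  rw [← neg_inj, ← this]
  abel

lemma spin_apply_coords (u : Mom) (x : V) : E.spin u x =
    u 0 • E.spin (axis 0) x + u 1 • E.spin (axis 1) x + u 2 • E.spin (axis 2) x := by
  conv_lhs => rw [coords_eq u]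
  simp only [map_add, map_smul]
  rfl

lemma spin_commutator (u v : Mom) (x : V) :
    E.spin u (E.spin v x) - E.spin v (E.spin u x) = E.spin (cross u v) x := by
  have h01 := E.spin_commutator_axis 0 1 x
  have h12 := E.spin_commutator_axis 1 2 x
  have h20 := E.spin_commutator_axis 2 0 x
  have c01 : cross (axis 0) (axis 1) = axis 2 := by
    ext i; fin_cases i <;> simp [cross, axis]
  have c12 : cross (axis 1) (axis 2) = axis 0 := by
    ext i; fin_cases i <;> simp [cross, axis]
  have c20 : cross (axis 2) (axis 0) = axis 1 := by
    ext i; fin_cases i <;> simp [cross, axis]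
  rw [c01, sub_eq_iff_eq_add] at h01
  rw [c12, sub_eq_iff_eq_add] at h12
  rw [c20, sub_eq_iff_eq_add] at h20
  simp only [E.spin_apply_coords u, E.spin_apply_coords v, E.spin_apply_coords (cross u v),
    map_add, ContinuousLinearMap.map_smul_of_tower, h01, h12, h20]
  simp only [cross, Matrix.cons_val_zero, Matrix.cons_val_one, Matrix.cons_val]
  module

/-- By the group law the derivative at any `t` is the derivative at `0` followed by a fixed map,
hence zero, and the orbit of `v` is constant. -/
lemma little_rotation_of_spin_eq_zero (h : ∀ c v, E.spin (axis c) v = 0) (a : Fin 3) (t : ℝ)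
    (v : V) : E.little (Matrix.of.symm (rotation a t)) v = v := by
  have hd (t : ℝ) :
      HasDerivAt (fun s => E.little (Matrix.of.symm (rotation a s)) v) 0 t := by
    have h1 := hasDerivAt_apply
      (hasDerivAt_const (0 : ℝ) (E.little (Matrix.of.symm (rotation a t))))
      (hasDerivAt_apply (E.hasDerivAt_little_rotation a) (hasDerivAt_const (0 : ℝ) v))
    have e (s : ℝ) : E.little (Matrix.of.symm (rotation a t))
        (E.little (Matrix.of.symm (rotation a s)) v)
        = E.little (Matrix.of.symm (rotation a (t + s))) v := by
      rw [← rotation_add, E.little_mul (rotation_mem _ _) (rotation_mem _ _)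
        (lorentzAct_rotation_zero _ _ _)]
    simp only [e, h, map_zero, add_zero] at h1
    have h2 : HasDerivAt (fun s : ℝ => s - t) 1 t := (hasDerivAt_id t).sub_const t
    rw [← sub_self t] at h1
    have := HasDerivAt.scomp (h := fun s => s - t) t h1 h2
    simpa [Function.comp_def] using this
  have := is_const_of_deriv_eq_zero (fun s => (hd s).differentiableAt) (fun s => (hd s).deriv) t 0
  simpa [rotation_zero, little_one] using this

lemma little_of_spin_eq_zero (h : ∀ c v, E.spin (axis c) v = 0)
    {W : Matrix (Fin 4) (Fin 4) ℝ} (hW : W ∈ lorentz) (h0 : ∀ i, W i 0 = ![1, 0, 0, 0] i) (v : V) :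
    E.little (Matrix.of.symm W) v = v := by
  obtain ⟨a, b, c, rfl⟩ := exists_euler hW h0
  rw [E.little_mul (rotation_mem _ _) (lorentz_mul (rotation_mem _ _) (rotation_mem _ _))
      (lorentzAct_rotation_mul_zero _ _ _ _ _),
    E.little_mul (rotation_mem _ _) (rotation_mem _ _) (lorentzAct_rotation_zero _ _ _)]
  simp only [E.little_rotation_of_spin_eq_zero h]

lemma exists_spin_ne_zero (hm : 0 < m) (hV : 1 < Module.finrank ℂ V) :
    ∃ c v, E.spin (axis c) v ≠ 0 := by
  by_contra! h
  have := E.nontrivial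
  obtain ⟨v, hv⟩ := exists_ne (0 : V)
  -- The candidate subbundle is the line through `v` carried to every fibre by the rest boosts.
  have hinv := E.irreducible (fun k => Submodule.span ℂ {E.gauge k v}) (by
    intro L hL b k w hw
    obtain ⟨c, rfl⟩ := Submodule.mem_span_singleton.1 hw
    obtain ⟨d, hd⟩ := E.act_eq_smul hL b k (c • E.gauge k v)
    rw [hd, map_smul, E.act_gauge hm hL]
    have hmem := lorentz_mul (restBoost_mem hm (-lorentzAct m L k))
      (lorentz_mul hL (restBoost_mem hm k))
    have hfix : (restBoost m (-lorentzAct m L k) * (L * restBoost m k)).mulVec (fourMom m 0) =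
        fourMom m 0 := by
      rw [← Matrix.mulVec_mulVec, ← Matrix.mulVec_mulVec, restBoost_mulVec hm,
        ← fourMom_lorentzAct hm hL, restBoost_neg_mulVec hm]
    rw [E.little_of_spin_eq_zero h hmem (fun i => ?_)]
    · exact Submodule.smul_mem _ _ (Submodule.smul_mem _ _ (Submodule.mem_span_singleton_self _))
    -- Fixing the rest four-momentum `(m, 0, 0, 0)` with `m ≠ 0` means that the first column is that
    -- of the identity.
    · generalize restBoost m (-lorentzAct m L k) * (L * restBoost m k) = W at hfix
      have := congrFun hfix i
      simp only [Matrix.mulVec, dotProduct, Fin.sum_univ_four, fourMom_zero, fourMom_one,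
        fourMom_two, fourMom_three, norm_zero, energy_zero hm, PiLp.zero_apply, mul_zero,
        add_zero] at this
      have hm0 := hm.ne'
      fin_cases i <;> simp [energy_zero hm, hm0] at this ⊢ <;> exact this)
  rcases hinv with hb | ht
  · have h1 := hb 0
    rw [Submodule.span_singleton_eq_bot] at h1
    have h2 := E.norm_gauge hm 0 v
    rw [h1, norm_zero] at h2
    exact hv (norm_eq_zero.1 h2.symm)
  · have h1 := finrank_span_le_card (R := ℂ) ({E.gauge 0 v} : Set V)
    rw [ht 0, finrank_top] at h1
    simp at h1
    omega

end Bundle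

namespace Bundle

variable {m : ℝ} {V : Type*} [NormedAddCommGroup V] [InnerProductSpace ℂ V] (E : Bundle m V)

/-! ### The operators in the gauge -/

/-- The connection which in the gauge of the rest boosts is
`X ↦ ∂_X - X·k / (2 ω²) + g S(X × k)`. -/
def gaugeConn (g : Mom → ℂ) : ConnOp V := fun X ψ k =>
  E.gauge k (fderiv ℝ (fun q => E.gaugeInv q (ψ q)) k (X k)
    - ((inner ℝ (X k) k * (2 * energy m ‖k‖ ^ 2)⁻¹ : ℝ) : ℂ) • E.gaugeInv k (ψ k)
    + g k • E.spin (cross (X k) k) (E.gaugeInv k (ψ k)))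

variable (hm : 0 < m) {ψ : Mom → V} {k : Mom} (hψ : DifferentiableAt ℝ ψ k)

lemma fderiv_coords {φ : Mom → V} (k x : Mom) : fderiv ℝ φ k x =
    (x 0 : ℂ) • fderiv ℝ φ k (axis 0) + (x 1 : ℂ) • fderiv ℝ φ k (axis 1)
      + (x 2 : ℂ) • fderiv ℝ φ k (axis 2) := by
  conv_lhs => rw [coords_eq x]
  simp only [map_add, map_smul, Complex.coe_smul]

lemma spin_coords (u : Mom) (x : V) : E.spin u x =
    (u 0 : ℂ) • E.spin (axis 0) x + (u 1 : ℂ) • E.spin (axis 1) x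
      + (u 2 : ℂ) • E.spin (axis 2) x := by
  simp only [Complex.coe_smul]
  exact E.spin_apply_coords u x

include hm hψ

/-- All derivatives of the section enter through three vectors `p` and all spin terms through three
vectors `s`. Operator identities thereby reduce to comparing scalar coefficients. -/
lemma J_eq_coords : ∃ p s : Fin 3 → V,
    (∀ x, fderiv ℝ (fun q => E.gaugeInv q (ψ q)) k x =
      (x 0 : ℂ) • p 0 + (x 1 : ℂ) • p 1 + (x 2 : ℂ) • p 2) ∧
    (∀ u, E.spin u (E.gaugeInv k (ψ k)) =
      (u 0 : ℂ) • s 0 + (u 1 : ℂ) • s 1 + (u 2 : ℂ) • s 2) ∧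
    (∀ a, E.J a ψ k = Complex.I • E.gauge k
      (s a + (k (a + 2) : ℂ) • p (a + 1) - (k (a + 1) : ℂ) • p (a + 2))) ∧
    (∀ a, E.K a ψ k = -(Complex.I • E.gauge k ((energy m ‖k‖ + m : ℂ)⁻¹ •
      ((k (a + 2) : ℂ) • s (a + 1) - (k (a + 1) : ℂ) • s (a + 2))
      - (energy m ‖k‖ : ℂ) • p a))) := by
  refine ⟨fun a => fderiv ℝ (fun q => E.gaugeInv q (ψ q)) k (axis a),
    fun a => E.spin (axis a) (E.gaugeInv k (ψ k)), fderiv_coords k,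
    fun u => E.spin_coords u _, fun a => ?_, fun a => ?_⟩
  · rw [E.J_eq hm hψ, fderiv_coords]
    congr 2
    fin_cases a <;> simp [cross, axis] <;> module
  · rw [E.K_eq hm hψ, E.spin_coords, ← Complex.coe_smul]
    congr 4
    fin_cases a <;> simp [cross, axis] <;> module

/-- `D^K` has spin coefficient `1 / (ω(ω + m)) = (1 - m/ω) / r²` and `D^R` has `1 / r²`, while their
derivative and scalar terms agree; the affine combination is read off. -/
lemma affineComb_eq (f : ℝ → ℂ) (hk : k ≠ 0) (X : Mom → Mom) :
    E.affineComb f X ψ k =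
      E.gaugeConn (fun k => (1 - f ‖k‖ * m / energy m ‖k‖) / (‖k‖ : ℂ) ^ 2) X ψ k := by
  obtain ⟨p, s, hp, hs, hJ, hK⟩ := E.J_eq_coords hm hψ
  have hφ := (E.gauge_gaugeInv hm k (ψ k)).symm
  have hr : (‖k‖ : ℂ) ^ 2 = (k 0 : ℂ) ^ 2 + (k 1 : ℂ) ^ 2 + (k 2 : ℂ) ^ 2 := by
    exact_mod_cast norm_sq_eq_coords k
  have hw : (energy m ‖k‖ : ℂ) ^ 2 = (‖k‖ : ℂ) ^ 2 + (m : ℂ) ^ 2 := by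
    exact_mod_cast energy_sq m ‖k‖
  have hr0 : (‖k‖ : ℂ) ≠ 0 := by exact_mod_cast norm_ne_zero_iff.2 hk
  have hw0 : (energy m ‖k‖ : ℂ) ≠ 0 := by exact_mod_cast (energy_pos hm ‖k‖).ne'
  have hwm : (energy m ‖k‖ + m : ℂ) ≠ 0 := by
    have := energy_pos hm ‖k‖
    exact_mod_cast (by positivity : energy m ‖k‖ + m ≠ 0)
  simp only [affineComb, ofComponents, boostComp, rotComp, Hpow, radial, mulOp, opP, opPhat,
    opCross, opDot, Pi.add_apply, Pi.sub_apply, Pi.neg_apply, Pi.smul_apply, Fin.sum_univ_three,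
    hJ, hK, gaugeConn, hp, hs, cross, inner_eq_coords]
  generalize E.gaugeInv k (ψ k) = φ at *
  rw [hφ]
  simp only [Fin.isValue, Fin.reduceAdd, Matrix.cons_val_zero, Matrix.cons_val_one, Matrix.cons_val]
  push_cast
  simp only [map_add, map_sub, map_smul]
  generalize E.gauge k φ = u
  generalize E.gauge k (p 0) = p0
  generalize E.gauge k (p 1) = p1
  generalize E.gauge k (p 2) = p2
  generalize E.gauge k (s 0) = s0
  generalize E.gauge k (s 1) = s1
  generalize E.gauge k (s 2) = s2
  generalize (energy m ‖k‖ : ℂ) = w at *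
  generalize (‖k‖ : ℂ) = r at *
  generalize f ‖k‖ = c
  generalize (k 0 : ℂ) = x at *
  generalize (k 1 : ℂ) = y at *
  generalize (k 2 : ℂ) = z at *
  generalize (X k 0 : ℂ) = X0
  generalize (X k 1 : ℂ) = X1
  generalize (X k 2 : ℂ) = X2
  generalize (m : ℂ) = μ at *
  have hI : Complex.I ^ 2 = -1 := Complex.I_sq
  generalize Complex.I = i at *
  match_scalars
  all_goals simp only [zpow_neg, zpow_ofNat, pow_one, mul_one]
  all_goals field_simp
  all_goals ring_nf
  all_goals grind

/-- The orbital parts of `H J` and `P × K` cancel, so the correction in `Q` is a pure spin term, and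
it removes exactly the spin term of `D^K`. -/
lemma newtonWigner_eq (X : Mom → Mom) :
    -(Complex.I • ofComponents E.newtonWigner X ψ k) = E.gaugeConn (fun _ => 0) X ψ k := by
  obtain ⟨p, s, hp, hs, hJ, hK⟩ := E.J_eq_coords hm hψ
  have hφ := (E.gauge_gaugeInv hm k (ψ k)).symm
  have hw : (energy m ‖k‖ : ℂ) ^ 2 = (k 0 : ℂ) ^ 2 + (k 1 : ℂ) ^ 2 + (k 2 : ℂ) ^ 2 + (m : ℂ) ^ 2 := by
    exact_mod_cast energy_sq_coords m k
  have hw0 : (energy m ‖k‖ : ℂ) ≠ 0 := by exact_mod_cast (energy_pos hm ‖k‖).ne'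
  have hm0 : (m : ℂ) ≠ 0 := by exact_mod_cast hm.ne'
  have hwm : (energy m ‖k‖ + m : ℂ) ≠ 0 := by
    have := energy_pos hm ‖k‖
    exact_mod_cast (by positivity : energy m ‖k‖ + m ≠ 0)
  simp only [newtonWigner, ofComponents, Hpow, radial, mulOp, opP,
    opCross, Pi.add_apply, Pi.sub_apply, Pi.smul_apply, Fin.sum_univ_three,
    hJ, hK, gaugeConn, hp, hs, cross, inner_eq_coords]
  generalize E.gaugeInv k (ψ k) = φ at *
  rw [hφ]
  simp only [Fin.isValue, Fin.reduceAdd, Matrix.cons_val_zero, Matrix.cons_val_one, Matrix.cons_val]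
  push_cast
  simp only [map_add, map_sub, map_smul]
  generalize E.gauge k φ = u
  generalize E.gauge k (p 0) = p0
  generalize E.gauge k (p 1) = p1
  generalize E.gauge k (p 2) = p2
  generalize E.gauge k (s 0) = s0
  generalize E.gauge k (s 1) = s1
  generalize E.gauge k (s 2) = s2
  generalize (energy m ‖k‖ : ℂ) = w at *
  generalize (k 0 : ℂ) = x at *
  generalize (k 1 : ℂ) = y at *
  generalize (k 2 : ℂ) = z at *
  generalize (X k 0 : ℂ) = X0
  generalize (X k 1 : ℂ) = X1
  generalize (X k 2 : ℂ) = X2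
  generalize (m : ℂ) = μ at *
  have hI : Complex.I ^ 2 = -1 := Complex.I_sq
  generalize Complex.I = i at *
  match_scalars
  all_goals simp only [zpow_neg, zpow_ofNat, pow_one, mul_one]
  all_goals field_simp
  all_goals ring_nf
  all_goals grind

/-- The orbital part of `J` is orthogonal to `k`, so only spin contributes to helicity. -/
lemma Jk_eq : E.Jk ψ k =
    Complex.I • E.gauge k (E.spin ((‖k‖⁻¹ : ℝ) • k) (E.gaugeInv k (ψ k))) := by
  obtain ⟨p, s, hp, hs, hJ, hK⟩ := E.J_eq_coords hm hψ
  simp only [Jk, opDot, opPhat, mulOp, Fin.sum_univ_three, Pi.add_apply, hJ, hs, PiLp.smul_apply]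
  simp only [Fin.isValue, Fin.reduceAdd, smul_eq_mul, div_eq_inv_mul, map_add, map_sub, map_smul,
    zero_add]
  push_cast
  module

end Bundle

/-- The cross product as a bilinear map. -/
def crossL : Mom →L[ℝ] Mom →L[ℝ] Mom :=
  LinearMap.toContinuousLinearMap
    { toFun := fun u => LinearMap.toContinuousLinearMap
        { toFun := cross u
          map_add' := fun v w => by ext i; fin_cases i <;> simp [cross] <;> ring
          map_smul' := fun c v => by ext i; fin_cases i <;> simp [cross] <;> ring }
      map_add' := fun u v => by ext w i; fin_cases i <;> simp [cross] <;> ring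
      map_smul' := fun c v => by ext w i; fin_cases i <;> simp [cross] <;> ring }

lemma crossL_apply (u v : Mom) : crossL u v = cross u v := rfl

lemma cross_add_left (u v w : Mom) : cross (u + v) w = cross u w + cross v w := by
  simp [← crossL_apply]

lemma cross_smul_left (c : ℝ) (u v : Mom) : cross (c • u) v = c • cross u v := by
  simp [← crossL_apply]

lemma cross_sub_left (u v w : Mom) : cross (u - v) w = cross u w - cross v w := by
  simp [← crossL_apply]

lemma cross_swap (u v : Mom) : cross u v = -cross v u := by
  ext i; fin_cases i <;> simp [cross] <;> ring

lemma fderiv_cross {Y Z : Mom → Mom} {k : Mom} (hY : DifferentiableAt ℝ Y k)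
    (hZ : DifferentiableAt ℝ Z k) (x : Mom) :
    DifferentiableAt ℝ (fun q => cross (Y q) (Z q)) k ∧
    fderiv ℝ (fun q => cross (Y q) (Z q)) k x =
      cross (fderiv ℝ Y k x) (Z k) + cross (Y k) (fderiv ℝ Z k x) := by
  have h := crossL.hasFDerivAt_of_bilinear hY.hasFDerivAt hZ.hasFDerivAt
  refine ⟨h.differentiableAt, ?_⟩
  refine (congrArg (fun L => L x) h.fderiv).trans ?_
  simp [crossL_apply, add_comm]

/-! ### Exchanging connections that agree on smooth fields and sections -/

section Transfer

variable {V : Type*} [NormedAddCommGroup V] [InnerProductSpace ℂ V] {U : Set Mom}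
  {D D' : ConnOp V}

lemma IsConnectionOn.of_eqOn (h : IsConnectionOn U D')
    (he : ∀ X ψ, ContDiffOn ℝ ∞ X U → ContDiffOn ℝ ∞ ψ U → Set.EqOn (D X ψ) (D' X ψ) U) :
    IsConnectionOn U D where
  smooth X ψ hX hψ := (h.smooth X ψ hX hψ).congr (he X ψ hX hψ)
  congr X X₁ ψ ψ₁ hX hψ hXX hψψ :=
    (he X ψ hX hψ).trans ((h.congr X X₁ ψ ψ₁ hX hψ hXX hψψ).trans
      (he X₁ ψ₁ (hX.congr hXX.symm) (hψ.congr hψψ.symm)).symm)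
  add_field X Y ψ hX hY hψ k hk := by
    rw [he (X + Y) _ (hX.add hY) hψ hk, he _ _ hX hψ hk, he _ _ hY hψ hk,
      h.add_field X Y ψ hX hY hψ k hk]
  smul_field g X ψ hg hX hψ k hk := by
    rw [he (fun q => g q • X q) _ (hg.smul hX) hψ hk, he _ _ hX hψ hk, h.smul_field g X ψ hg hX hψ k hk]
  add_section X ψ χ hX hψ hχ k hk := by
    rw [he _ (ψ + χ) hX (hψ.add hχ) hk, he _ _ hX hψ hk, he _ _ hX hχ hk,
      h.add_section X ψ χ hX hψ hχ k hk]
  leibniz g X ψ hg hX hψ k hk := by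
    rw [he _ (fun q => g q • ψ q) hX (hg.smul hψ) hk, he _ _ hX hψ hk, h.leibniz g X ψ hg hX hψ k hk]

lemma contDiffOn_fderiv_apply {F G : Type*} [NormedAddCommGroup F] [NormedSpace ℝ F]
    [NormedAddCommGroup G] [NormedSpace ℝ G] {f : F → G} {X : F → F} {U : Set F} (hU : IsOpen U)
    (hf : ContDiffOn ℝ ∞ f U) (hX : ContDiffOn ℝ ∞ X U) :
    ContDiffOn ℝ ∞ (fun q => fderiv ℝ f q (X q)) U :=
  (hf.fderiv_of_isOpen hU (by simp)).clm_apply hX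

lemma contDiffOn_lieBracket {X Y : Mom → Mom} (hU : IsOpen U) (hX : ContDiffOn ℝ ∞ X U)
    (hY : ContDiffOn ℝ ∞ Y U) : ContDiffOn ℝ ∞ (VectorField.lieBracket ℝ X Y) U :=
  (contDiffOn_fderiv_apply hU hY hX).sub (contDiffOn_fderiv_apply hU hX hY)

/-- In the iterated terms the inner sections agree only on `U`, so the locality of `D'` is needed as
well as the agreement of the two maps. -/
lemma IsConnectionOn.curvature_congr (h : IsConnectionOn U D') (hU : IsOpen U)
    (he : ∀ X ψ, ContDiffOn ℝ ∞ X U → ContDiffOn ℝ ∞ ψ U → Set.EqOn (D X ψ) (D' X ψ) U)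
    {X Y : Mom → Mom} {ψ : Mom → V} (hX : ContDiffOn ℝ ∞ X U) (hY : ContDiffOn ℝ ∞ Y U)
    (hψ : ContDiffOn ℝ ∞ ψ U) {k : Mom} (hk : k ∈ U) :
    curvature D X Y ψ k = curvature D' X Y ψ k := by
  have key : ∀ X Y : Mom → Mom, ContDiffOn ℝ ∞ X U → ContDiffOn ℝ ∞ Y U →
      D X (D Y ψ) k = D' X (D' Y ψ) k := fun X Y hX hY => by
    have hs := h.smooth Y ψ hY hψ
    have hs' := hs.congr (he Y ψ hY hψ)
    rw [he X _ hX hs' hk]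
    exact h.congr X X _ _ hX hs' (Set.eqOn_refl _ _) (he Y ψ hY hψ) hk
  simp only [curvature, Pi.sub_apply]
  rw [key X Y hX hY, key Y X hY hX, he _ _ (contDiffOn_lieBracket hU hX hY) hψ hk]

end Transfer

/-! ### The connection form in the gauge and its curvature -/

namespace Bundle

variable {m : ℝ} {V : Type*} [NormedAddCommGroup V] [InnerProductSpace ℂ V] (E : Bundle m V)

/-- The connection form of `gaugeConn`. -/
def gaugeForm (g : Mom → ℂ) (Y : Mom → Mom) (q : Mom) : V →L[ℂ] V :=
  g q • E.spin (cross (Y q) q)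
    - (inner ℝ (Y q) q * (2 * energy m ‖q‖ ^ 2)⁻¹) • ContinuousLinearMap.id ℂ V

lemma gaugeConn_eq (g : Mom → ℂ) (X : Mom → Mom) (ψ : Mom → V) (k : Mom) :
    E.gaugeConn g X ψ k = E.gauge k (fderiv ℝ (fun q => E.gaugeInv q (ψ q)) k (X k)
      + E.gaugeForm g X k (E.gaugeInv k (ψ k))) := by
  simp only [gaugeConn, gaugeForm, Complex.coe_smul, sub_apply,
    smul_apply, ContinuousLinearMap.id_apply]
  congr 1
  abel

variable (hm : 0 < m) {U : Set Mom} (hU : IsOpen U)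

include hm

lemma contDiff_inv_energy_sq : ContDiff ℝ ∞ fun q : Mom => (2 * energy m ‖q‖ ^ 2)⁻¹ :=
  (contDiff_const.mul ((energy_contDiff hm).pow 2)).inv fun q => by
    have := energy_pos hm ‖q‖
    positivity

/-- Only proportionality of the gradient to `k` matters: the resulting term of `dA(X, Y)` is
symmetric in `X` and `Y` and drops out, whatever `c` is. -/
lemma exists_fderiv_inv_energy_sq (k : Mom) : ∃ c : ℝ, ∀ x,
    fderiv ℝ (fun q : Mom => (2 * energy m ‖q‖ ^ 2)⁻¹) k x = c * inner ℝ k x := by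
  have h1 := ((hasStrictFDerivAt_norm_sq k).hasFDerivAt.add_const (m ^ 2)).const_mul 2
  have h0 : 2 * (‖k‖ ^ 2 + m ^ 2) ≠ 0 := by positivity
  have h2 := (hasDerivAt_inv h0).comp_hasFDerivAt k h1
  have e : (fun q : Mom => (2 * energy m ‖q‖ ^ 2)⁻¹) = (·⁻¹) ∘ fun q : Mom => 2 * (‖q‖ ^ 2 + m ^ 2) := by
    ext q; simp [energy_sq]
  refine ⟨-((2 * (‖k‖ ^ 2 + m ^ 2)) ^ 2)⁻¹ * 4, fun x => ?_⟩
  rw [e, h2.fderiv]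
  simp only [smul_apply, innerSL_apply_apply, smul_eq_mul, nsmul_eq_mul]
  push_cast
  ring

lemma gaugeForm_contDiffOn {g : Mom → ℂ} {Y : Mom → Mom} (hg : ContDiffOn ℝ ∞ g U)
    (hY : ContDiffOn ℝ ∞ Y U) : ContDiffOn ℝ ∞ (E.gaugeForm g Y) U := by
  have hc : ContDiffOn ℝ ∞ (fun q => cross (Y q) q) U :=
    (crossL.contDiff.comp_contDiffOn hY).clm_apply contDiffOn_id
  exact (hg.smul (E.spin.contDiff.comp_contDiffOn hc)).sub
    (((hY.inner ℝ contDiffOn_id).mul (contDiff_inv_energy_sq hm).contDiffOn).smul contDiffOn_const)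

lemma fderiv_gaugeForm {g : Mom → ℂ} {Y : Mom → Mom} {k : Mom} (hg : DifferentiableAt ℝ g k)
    (hY : DifferentiableAt ℝ Y k) {c : ℝ}
    (hc : ∀ x, fderiv ℝ (fun q : Mom => (2 * energy m ‖q‖ ^ 2)⁻¹) k x = c * inner ℝ k x) (x : Mom) :
    fderiv ℝ (E.gaugeForm g Y) k x =
      fderiv ℝ g k x • E.spin (cross (Y k) k)
        + g k • E.spin (cross (fderiv ℝ Y k x) k + cross (Y k) x)
        - ((inner ℝ (fderiv ℝ Y k x) k + inner ℝ (Y k) x) * (2 * energy m ‖k‖ ^ 2)⁻¹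
          + inner ℝ (Y k) k * (c * inner ℝ k x)) • ContinuousLinearMap.id ℂ V := by
  have hcr := fderiv_cross hY differentiableAt_id x
  have hs : DifferentiableAt ℝ (fun q => E.spin (cross (Y q) q)) k :=
    E.spin.differentiableAt.comp k hcr.1
  have hs' : fderiv ℝ (fun q => E.spin (cross (Y q) q)) k x =
      E.spin (cross (fderiv ℝ Y k x) k + cross (Y k) x) := by
    have := (E.spin.hasFDerivAt.comp k hcr.1.hasFDerivAt).fderiv
    refine (congrArg (fun L => L x) this).trans ?_
    have h2 := hcr.2
    rw [fderiv_id, ContinuousLinearMap.id_apply] at h2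
    exact congrArg E.spin h2
  have ha := ((contDiff_inv_energy_sq hm).contDiffAt (x := k)).differentiableAt (by simp)
  have hi : DifferentiableAt ℝ (fun q => inner ℝ (Y q) q) k := hY.inner ℝ differentiableAt_id
  have hi' : fderiv ℝ (fun q => inner ℝ (Y q) q) k x =
      inner ℝ (Y k) x + inner ℝ (fderiv ℝ Y k x) k := by
    have := fderiv_inner_apply ℝ hY (differentiableAt_id (x := k)) x
    simpa using this
  have h := (hg.hasFDerivAt.smul hs.hasFDerivAt).sub
    ((hi.hasFDerivAt.mul ha.hasFDerivAt).smul_const (ContinuousLinearMap.id ℂ V))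
  refine (congrArg (fun L => L x) h.fderiv).trans ?_
  simp only [sub_apply, add_apply,
    smul_apply, ContinuousLinearMap.smulRight_apply, hs', hi', hc]
  rw [add_comm (g k • _)]
  congr 2
  simp only [smul_eq_mul]
  ring

end Bundle

namespace Bundle

variable {m : ℝ} {V : Type*} [NormedAddCommGroup V] [InnerProductSpace ℂ V] (E : Bundle m V)

lemma gaugeForm_add (g : Mom → ℂ) (X Y : Mom → Mom) (k : Mom) :
    E.gaugeForm g (X + Y) k = E.gaugeForm g X k + E.gaugeForm g Y k := by
  simp only [gaugeForm, Pi.add_apply, cross_add_left, map_add, inner_add_left, smul_add, add_mul,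
    add_smul]
  abel

lemma gaugeForm_smul (g : Mom → ℂ) (h : Mom → ℝ) (X : Mom → Mom) (k : Mom) :
    E.gaugeForm g (fun q => h q • X q) k = h k • E.gaugeForm g X k := by
  simp only [gaugeForm, cross_smul_left, map_smul, real_inner_smul_left, smul_sub, mul_assoc,
    mul_smul, smul_comm (h k) (g k)]

variable (hm : 0 < m) {U : Set Mom} (hU : IsOpen U)

include hm

lemma gaugeInv_contDiffOn {ψ : Mom → V} (hψ : ContDiffOn ℝ ∞ ψ U) :
    ContDiffOn ℝ ∞ (fun q => E.gaugeInv q (ψ q)) U :=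
  contDiffOn_apply (E.gaugeInv_contDiff hm).contDiffOn hψ

lemma gaugeInv_gaugeConn (g : Mom → ℂ) (X : Mom → Mom) (ψ : Mom → V) :
    (fun k => E.gaugeInv k (E.gaugeConn g X ψ k)) =
      fun k => fderiv ℝ (fun q => E.gaugeInv q (ψ q)) k (X k)
        + E.gaugeForm g X k (E.gaugeInv k (ψ k)) := by
  ext k
  rw [gaugeConn_eq, E.gaugeInv_gauge hm]

include hU

lemma gaugeConn_isConnectionOn {g : Mom → ℂ} (hg : ContDiffOn ℝ ∞ g U) :
    IsConnectionOn U (E.gaugeConn g) where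
  smooth X ψ hX hψ := by
    have hφ := E.gaugeInv_contDiffOn hm hψ
    have h := contDiffOn_apply (E.gauge_contDiff hm).contDiffOn
      ((contDiffOn_fderiv_apply hU hφ hX).add
        (contDiffOn_apply (E.gaugeForm_contDiffOn hm hg hX) hφ))
    exact h.congr fun k _ => E.gaugeConn_eq g X ψ k
  congr X X₁ ψ ψ₁ hX hψ hXX hψψ k hk := by
    have hev : (fun q => E.gaugeInv q (ψ q)) =ᶠ[nhds k] fun q => E.gaugeInv q (ψ₁ q) := by
      filter_upwards [hU.mem_nhds hk] with q hq
      rw [hψψ hq]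
    simp only [gaugeConn, hev.fderiv_eq, hXX hk, hψψ hk]
  add_field X Y ψ hX hY hψ k hk := by
    simp only [gaugeConn_eq, gaugeForm_add, Pi.add_apply, map_add, add_apply]
    abel
  smul_field h X ψ hh hX hψ k hk := by
    simp only [gaugeConn_eq, gaugeForm_smul, map_smul, map_add, smul_apply,
      smul_add, ContinuousLinearMap.map_smul_of_tower]
  add_section X ψ χ hX hψ hχ k hk := by
    have d1 := ((E.gaugeInv_contDiffOn hm hψ).contDiffAt (hU.mem_nhds hk)).differentiableAt
      (by simp)
    have d2 := ((E.gaugeInv_contDiffOn hm hχ).contDiffAt (hU.mem_nhds hk)).differentiableAt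
      (by simp)
    have h := fderiv_fun_add d1 d2
    simp only [gaugeConn_eq, Pi.add_apply, map_add, h, add_apply]
    abel
  leibniz h X ψ hh hX hψ k hk := by
    have d1 := ((E.gaugeInv_contDiffOn hm hψ).contDiffAt (hU.mem_nhds hk)).differentiableAt
      (by simp)
    have d2 := (hh.contDiffAt (hU.mem_nhds hk)).differentiableAt (by simp)
    have h := fderiv_fun_smul d2 d1
    simp only [gaugeConn_eq, map_smul, map_add, h, add_apply,
      smul_apply, ContinuousLinearMap.smulRight_apply, E.gauge_gaugeInv hm,
      smul_add]
    abel

lemma fderiv_gaugeInv_gaugeConn {g : Mom → ℂ} (hg : ContDiffOn ℝ ∞ g U) {Y : Mom → Mom}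
    {ψ : Mom → V} (hY : ContDiffOn ℝ ∞ Y U) (hψ : ContDiffOn ℝ ∞ ψ U) {k : Mom} (hk : k ∈ U)
    (x : Mom) :
    fderiv ℝ (fun q => E.gaugeInv q (E.gaugeConn g Y ψ q)) k x =
      fderiv ℝ (fderiv ℝ (fun q => E.gaugeInv q (ψ q))) k x (Y k)
      + fderiv ℝ (fun q => E.gaugeInv q (ψ q)) k (fderiv ℝ Y k x)
      + (fderiv ℝ (E.gaugeForm g Y) k x (E.gaugeInv k (ψ k))
      + E.gaugeForm g Y k (fderiv ℝ (fun q => E.gaugeInv q (ψ q)) k x)) := by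
  have hφ := E.gaugeInv_contDiffOn hm hψ
  have hφd := (hφ.contDiffAt (hU.mem_nhds hk)).differentiableAt (by simp)
  have hφd2 := ((hφ.fderiv_of_isOpen hU (m := ∞) (by simp)).contDiffAt
    (hU.mem_nhds hk)).differentiableAt (by simp)
  have hYd := (hY.contDiffAt (hU.mem_nhds hk)).differentiableAt (by simp)
  have hAd := ((E.gaugeForm_contDiffOn hm hg hY).contDiffAt (hU.mem_nhds hk)).differentiableAt
    (by simp)
  have h2 := hasFDerivAt_apply hAd hφd x
  have h1 := hφd2.hasFDerivAt.clm_apply hYd.hasFDerivAt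
  rw [E.gaugeInv_gaugeConn hm, fderiv_fun_add h1.differentiableAt h2.1,
    add_apply, h2.2, h1.fderiv]
  congr 1
  simp [add_comm]

/-- This is `dA + A ∧ A`. The scalar part of `A` is closed and central, hence invisible;
differentiating `g S(X × k)` gives the first three terms, and the commutator of the spin parts gives
the last. -/
lemma curvature_gaugeConn {g : Mom → ℂ} (hg : ContDiffOn ℝ ∞ g U) {X Y : Mom → Mom}
    {ψ : Mom → V} (hX : ContDiffOn ℝ ∞ X U) (hY : ContDiffOn ℝ ∞ Y U) (hψ : ContDiffOn ℝ ∞ ψ U)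
    {k : Mom} (hk : k ∈ U) :
    curvature (E.gaugeConn g) X Y ψ k = E.gauge k
      (fderiv ℝ g k (X k) • E.spin (cross (Y k) k) (E.gaugeInv k (ψ k))
      - fderiv ℝ g k (Y k) • E.spin (cross (X k) k) (E.gaugeInv k (ψ k))
      - (2 * g k) • E.spin (cross (X k) (Y k)) (E.gaugeInv k (ψ k))
      + g k ^ 2 • E.spin (cross (cross (X k) k) (cross (Y k) k)) (E.gaugeInv k (ψ k))) := by
  have hgd := (hg.contDiffAt (hU.mem_nhds hk)).differentiableAt (by simp)
  have hXd := (hX.contDiffAt (hU.mem_nhds hk)).differentiableAt (by simp)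
  have hYd := (hY.contDiffAt (hU.mem_nhds hk)).differentiableAt (by simp)
  obtain ⟨c, hc⟩ := exists_fderiv_inv_energy_sq hm k
  have hφ := E.gaugeInv_contDiffOn hm hψ
  -- Symmetry of the second derivative cancels the second-order terms; the bracket `[X, Y]` absorbs
  -- the derivatives of the fields.
  have hsymm := (hφ.contDiffAt (hU.mem_nhds hk)).isSymmSndFDerivAt
    (by simpa only [minSmoothness_of_isRCLikeNormedField] using ENat.LEInfty.out) (X k) (Y k)
  rw [← E.spin_commutator (cross (X k) k) (cross (Y k) k)]
  simp only [curvature, Pi.sub_apply]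
  rw [E.gaugeConn_eq g X (E.gaugeConn g Y ψ), E.gaugeConn_eq g Y (E.gaugeConn g X ψ),
    E.fderiv_gaugeInv_gaugeConn hm hU hg hY hψ hk, E.fderiv_gaugeInv_gaugeConn hm hU hg hX hψ hk,
    E.fderiv_gaugeForm hm hgd hXd hc, E.fderiv_gaugeForm hm hgd hYd hc, hsymm]
  simp only [E.gaugeConn_eq, E.gaugeInv_gauge hm, ← map_sub]
  congr 1
  generalize fderiv ℝ (fun q => E.gaugeInv q (ψ q)) k = φ'
  generalize fderiv ℝ (fderiv ℝ (fun q => E.gaugeInv q (ψ q))) k (Y k) (X k) = s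
  generalize E.gaugeInv k (ψ k) = φ
  rw [cross_swap (Y k) (X k)]
  simp only [VectorField.lieBracket, gaugeForm, sub_apply,
    add_apply, smul_apply, ContinuousLinearMap.id_apply,
    map_add, map_sub, map_neg, neg_apply, cross_sub_left, inner_sub_left,
    map_smul, ContinuousLinearMap.map_smul_of_tower, real_inner_comm (X k) (Y k),
    real_inner_comm (X k) k, real_inner_comm (Y k) k]
  simp only [← Complex.coe_smul]
  push_cast
  module

end Bundle

/-! ### Transverse vectors -/

lemma cross_cross_cross (x y k : Mom) :
    cross (cross x k) (cross y k) = inner ℝ k (cross x y) • k := by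
  rw [inner_eq_coords]
  ext i; fin_cases i <;> simp [cross] <;> ring

/-- Both vectors lie in the plane orthogonal to `k`, so their cross product is its own projection
onto `k`. -/
lemma cross_of_transverse {x y k : Mom} (hk : k ≠ 0) (hx : inner ℝ x k = 0) (hy : inner ℝ y k = 0) :
    cross x y = (inner ℝ k (cross x y) / ‖k‖ ^ 2) • k := by
  have h0 : ‖k‖ ^ 2 ≠ 0 := pow_ne_zero 2 (norm_ne_zero_iff.2 hk)
  have h : ‖k‖ ^ 2 • cross x y = inner ℝ k (cross x y) • k := by
    rw [inner_eq_coords] at hx hy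
    rw [inner_eq_coords, norm_sq_eq_coords]
    ext i; fin_cases i <;> simp [cross]
    · linear_combination (-(k 1 * x 2) + k 2 * x 1) * hy + (k 1 * y 2 - k 2 * y 1) * hx
    · linear_combination (-(k 2 * x 0) + k 0 * x 2) * hy + (k 2 * y 0 - k 0 * y 2) * hx
    · linear_combination (-(k 0 * x 1) + k 1 * x 0) * hy + (k 0 * y 1 - k 1 * y 0) * hx
  rw [div_eq_inv_mul, mul_smul, ← h, smul_smul, inv_mul_cancel₀ h0, one_smul]

lemma fderiv_radial_of_transverse {G : ℝ → ℂ} {k x : Mom} (hk : k ≠ 0)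
    (hG : DifferentiableAt ℝ G ‖k‖) (hx : inner ℝ x k = 0) :
    fderiv ℝ (fun q : Mom => G ‖q‖) k x = 0 := by
  have h1 : DifferentiableAt ℝ (fun q : Mom => ‖q‖) k := differentiableAt_id.norm ℝ hk
  have h2 : fderiv ℝ (fun q : Mom => ‖q‖) k x = 0 := by
    -- Differentiating `‖q‖²` in two ways gives `‖k‖ d‖·‖(x) = k·x = 0`, up to a factor two.
    have h3 := (h1.hasFDerivAt.pow 2).fderiv
    have h4 := congrArg (fun L => L x) ((hasStrictFDerivAt_norm_sq k).hasFDerivAt.fderiv.symm.trans h3)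
    have hx' : inner ℝ k x = 0 := by rw [real_inner_comm]; exact hx
    simp [hx'] at h4
    exact h4.resolve_left hk
  have := (hG.hasFDerivAt.comp k h1.hasFDerivAt).fderiv
  refine (congrArg (fun L => L x) this).trans ?_
  simp [h2]

/-! ### The spherical unit vectors -/

lemma isOpen_off_axis : IsOpen {k : Mom | k 0 ^ 2 + k 1 ^ 2 ≠ 0} :=
  isOpen_ne_fun (by fun_prop) continuous_const

lemma off_axis_subset : {k : Mom | k 0 ^ 2 + k 1 ^ 2 ≠ 0} ⊆ {0}ᶜ := by
  rintro k hk rfl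
  exact hk (by simp)

lemma contDiffOn_sqrt_off_axis :
    ContDiffOn ℝ ∞ (fun k : Mom => Real.sqrt (k 0 ^ 2 + k 1 ^ 2)) {k | k 0 ^ 2 + k 1 ^ 2 ≠ 0} :=
  ContDiffOn.sqrt (by fun_prop) fun _ hk => hk

lemma sqrt_off_axis_ne_zero {k : Mom} (hk : k 0 ^ 2 + k 1 ^ 2 ≠ 0) :
    Real.sqrt (k 0 ^ 2 + k 1 ^ 2) ≠ 0 :=
  (Real.sqrt_ne_zero (by positivity)).2 hk

lemma contDiffOn_ePhi : ContDiffOn ℝ ∞ ePhi {k | k 0 ^ 2 + k 1 ^ 2 ≠ 0} := by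
  have hs := contDiffOn_sqrt_off_axis
  have hc (i : Fin 3) : ContDiffOn ℝ ∞ (fun k : Mom => k i) {k | k 0 ^ 2 + k 1 ^ 2 ≠ 0} := by
    fun_prop
  have hd (i : Fin 3) := (hc i).div hs fun k hk => sqrt_off_axis_ne_zero hk
  rw [contDiffOn_euclidean]
  intro i
  fin_cases i
  · exact (hd 1).neg
  · exact hd 0
  · exact contDiffOn_const

lemma contDiffOn_eTheta : ContDiffOn ℝ ∞ eTheta {k | k 0 ^ 2 + k 1 ^ 2 ≠ 0} := by
  have hs := contDiffOn_sqrt_off_axis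
  have hc (i : Fin 3) : ContDiffOn ℝ ∞ (fun k : Mom => k i) {k | k 0 ^ 2 + k 1 ^ 2 ≠ 0} := by
    fun_prop
  have hd (i : Fin 3) := (hc i).div hs fun k hk => sqrt_off_axis_ne_zero hk
  have hn : ContDiffOn ℝ ∞ (fun k : Mom => ‖k‖) {k | k 0 ^ 2 + k 1 ^ 2 ≠ 0} :=
    contDiffOn_id.norm ℝ fun k hk => off_axis_subset hk
  have hn0 : ∀ k ∈ {k : Mom | k 0 ^ 2 + k 1 ^ 2 ≠ 0}, ‖k‖ ≠ 0 :=
    fun k hk => norm_ne_zero_iff.2 (off_axis_subset hk)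
  rw [contDiffOn_euclidean]
  intro i
  fin_cases i
  · exact ((hc 2).div hn hn0).mul (hd 0)
  · exact ((hc 2).div hn hn0).mul (hd 1)
  · exact (hs.div hn hn0).neg

lemma transverseOn_ePhi (U : Set Mom) : TransverseOn U ePhi := by
  intro k _
  simp [inner_eq_coords, ePhi]
  ring

lemma transverseOn_eTheta : TransverseOn {k | k 0 ^ 2 + k 1 ^ 2 ≠ 0} eTheta := by
  intro k hk
  have h0 := sqrt_off_axis_ne_zero hk
  have hn0 := norm_ne_zero_iff.2 (off_axis_subset hk)
  have hs : Real.sqrt (k 0 ^ 2 + k 1 ^ 2) ^ 2 = k 0 ^ 2 + k 1 ^ 2 := Real.sq_sqrt (by positivity)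
  simp only [inner_eq_coords, eTheta, Matrix.cons_val_zero, Matrix.cons_val_one, Matrix.cons_val]
  field_simp
  rw [hs]
  ring

lemma inner_cross_eTheta_ePhi {k : Mom} (hk : k 0 ^ 2 + k 1 ^ 2 ≠ 0) :
    inner ℝ (‖k‖⁻¹ • k) (cross (eTheta k) (ePhi k)) = 1 := by
  have h0 := sqrt_off_axis_ne_zero hk
  have hn0 := norm_ne_zero_iff.2 (off_axis_subset hk)
  have hn := norm_sq_eq_coords k
  have hs : Real.sqrt (k 0 ^ 2 + k 1 ^ 2) ^ 2 = k 0 ^ 2 + k 1 ^ 2 := Real.sq_sqrt (by positivity)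
  simp only [inner_eq_coords, eTheta, ePhi, cross, PiLp.smul_apply, smul_eq_mul,
    Matrix.cons_val_zero, Matrix.cons_val_one, Matrix.cons_val]
  generalize Real.sqrt (k 0 ^ 2 + k 1 ^ 2) = s at *
  field_simp
  rw [hn]
  ring_nf
  simp only [hs]
  ring

lemma contDiff_cross_const (u : Mom) : ContDiff ℝ ∞ fun q => cross u q :=
  (crossL u).contDiff

lemma inner_cross_self (u k : Mom) : inner ℝ (cross u k) k = 0 := by
  simp [inner_eq_coords, cross]
  ring

lemma norm_axis (c : Fin 3) : ‖axis c‖ = 1 := by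
  simp [axis]

lemma inner_axis_cross (c : Fin 3) (r : ℝ) :
    inner ℝ (axis c) (cross (cross (axis (c + 1)) (r • axis c)) (cross (axis (c + 2)) (r • axis c)))
      = r ^ 2 := by
  fin_cases c <;> simp [inner_eq_coords, cross, axis] <;> ring

lemma cross_axis_axis (c : Fin 3) : cross (axis (c + 1)) (axis (c + 2)) = axis c := by
  fin_cases c <;> ext i <;> fin_cases i <;> simp [cross, axis]

lemma inner_axis_axis (c : Fin 3) : inner ℝ (axis (c + 1)) (axis (c + 2)) = 0 := by
  fin_cases c <;> simp [inner_eq_coords, axis]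

namespace Bundle

variable {m : ℝ} {V : Type*} [NormedAddCommGroup V] [InnerProductSpace ℂ V] (E : Bundle m V)

/-- The radial coefficient of the spin term of `D^f` in the gauge. -/
def coeff (_E : Bundle m V) (f : ℝ → ℂ) (r : ℝ) : ℂ :=
  (1 - f r * m / energy m r) / (r : ℂ) ^ 2

variable (hm : 0 < m)
include hm

lemma coeff_contDiffOn {f : ℝ → ℂ} (hf : ContDiffOn ℝ ∞ f (Set.Ioi 0)) :
    ContDiffOn ℝ ∞ (E.coeff f) (Set.Ioi 0) := by
  have hw : ContDiffOn ℝ ∞ (fun r : ℝ => (energy m r : ℂ)) (Set.Ioi 0) :=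
    Complex.ofRealCLM.contDiff.comp_contDiffOn
      (ContDiffOn.sqrt (by fun_prop) fun r _ => by positivity)
  have hr : ContDiffOn ℝ ∞ (fun r : ℝ => (r : ℂ) ^ 2) (Set.Ioi 0) :=
    (Complex.ofRealCLM.contDiff.pow 2).contDiffOn
  have hw' := hw.inv fun r _ => by exact_mod_cast (energy_pos hm r).ne'
  have hr' := hr.inv fun r hr => pow_ne_zero 2 (by exact_mod_cast (ne_of_gt hr))
  unfold coeff
  simp only [div_eq_mul_inv]
  exact (contDiffOn_const.sub ((hf.mul contDiffOn_const).mul hw')).mul hr'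

lemma coeff_norm_contDiffOn {f : ℝ → ℂ} (hf : ContDiffOn ℝ ∞ f (Set.Ioi 0)) :
    ContDiffOn ℝ ∞ (fun k : Mom => E.coeff f ‖k‖) {0}ᶜ :=
  (E.coeff_contDiffOn hm hf).comp (contDiffOn_id.norm ℝ fun _ hk => hk)
    fun _ hk => norm_pos_iff.2 hk

variable {U : Set Mom} (hU : IsOpen U)

omit hm in
include hU in
lemma differentiableAt_of_mem {ψ : Mom → V} (hψ : ContDiffOn ℝ ∞ ψ U) {k : Mom} (hk : k ∈ U) :
    DifferentiableAt ℝ ψ k :=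
  (hψ.contDiffAt (hU.mem_nhds hk)).differentiableAt (by simp)

include hU

lemma affineComb_eqOn (f : ℝ → ℂ) (h0 : U ⊆ {0}ᶜ) (X : Mom → Mom) (ψ : Mom → V)
    (hψ : ContDiffOn ℝ ∞ ψ U) :
    Set.EqOn (E.affineComb f X ψ) (E.gaugeConn (fun k => E.coeff f ‖k‖) X ψ) U :=
  fun _ hk => E.affineComb_eq hm (differentiableAt_of_mem hU hψ hk) f (h0 hk) X

/-- On transverse fields the radial `g` has zero derivative and every spin argument is a multiple of
`k`. What is left is `g² - 2g/r² = (f² m²/ω² - 1) / r⁴`, a rewriting of the stated factor by `ω² =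
r² + m²`. -/
lemma curvature_affineComb {f : ℝ → ℂ} (hf : ContDiffOn ℝ ∞ f (Set.Ioi 0)) (h0 : U ⊆ {0}ᶜ)
    {X Y : Mom → Mom} {ψ : Mom → V} (hX : ContDiffOn ℝ ∞ X U) (hY : ContDiffOn ℝ ∞ Y U)
    (hψ : ContDiffOn ℝ ∞ ψ U) (hXt : TransverseOn U X) (hYt : TransverseOn U Y)
    {k : Mom} (hk : k ∈ U) :
    curvature (E.affineComb f) X Y ψ k =
      (Complex.I * (f ‖k‖ ^ 2 / (energy m ‖k‖ : ℂ) ^ 2 + (1 - f ‖k‖ ^ 2) / (‖k‖ : ℂ) ^ 2)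
        * ((inner ℝ (‖k‖⁻¹ • k) (cross (X k) (Y k)) : ℝ) : ℂ)) • E.Jk ψ k := by
  have hk0 : k ≠ 0 := h0 hk
  have hg := (E.coeff_norm_contDiffOn hm hf).mono h0
  have hG : DifferentiableAt ℝ (E.coeff f) ‖k‖ :=
    ((E.coeff_contDiffOn hm hf).contDiffAt (Ioi_mem_nhds (norm_pos_iff.2 hk0))).differentiableAt
      (by simp)
  rw [(E.gaugeConn_isConnectionOn hm hU hg).curvature_congr hU
      (fun X ψ _ hψ => E.affineComb_eqOn hm hU f h0 X ψ hψ) hX hY hψ hk,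
    E.curvature_gaugeConn hm hU hg hX hY hψ hk, E.Jk_eq hm (differentiableAt_of_mem hU hψ hk),
    fderiv_radial_of_transverse hk0 hG (hXt k hk), fderiv_radial_of_transverse hk0 hG (hYt k hk),
    cross_cross_cross, real_inner_smul_left]
  have hc := cross_of_transverse hk0 (hXt k hk) (hYt k hk)
  generalize inner ℝ k (cross (X k) (Y k)) = l at *
  rw [hc]
  simp only [map_smul, smul_apply, ← Complex.coe_smul, map_add, map_sub,
    zero_smul, map_zero, coeff]
  generalize E.gauge k (E.spin k (E.gaugeInv k (ψ k))) = v
  have hw : (energy m ‖k‖ : ℂ) ^ 2 = (‖k‖ : ℂ) ^ 2 + (m : ℂ) ^ 2 := by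
    exact_mod_cast energy_sq m ‖k‖
  have hr0 : (‖k‖ : ℂ) ≠ 0 := by exact_mod_cast norm_ne_zero_iff.2 hk0
  have hw0 : (energy m ‖k‖ : ℂ) ≠ 0 := by exact_mod_cast (energy_pos hm ‖k‖).ne'
  push_cast
  generalize (energy m ‖k‖ : ℂ) = w at *
  generalize (‖k‖ : ℂ) = r at *
  generalize f ‖k‖ = c
  have hI : Complex.I ^ 2 = -1 := Complex.I_sq
  generalize Complex.I = i at *
  match_scalars
  field_simp
  grind

end Bundle

namespace Bundle

variable {m : ℝ} {V : Type*} [NormedAddCommGroup V] [InnerProductSpace ℂ V] (E : Bundle m V)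

/-! ### Sections that are constant in the gauge -/

variable (hm : 0 < m)
include hm

lemma gaugeInv_const (v : V) : (fun q => E.gaugeInv q (E.gauge q v)) = fun _ => v :=
  funext fun q => E.gaugeInv_gauge hm q v

lemma contDiff_gauge_const (v : V) : ContDiff ℝ ∞ fun q => E.gauge q v := by
  rw [← contDiffOn_univ]
  exact contDiffOn_apply (E.gauge_contDiff hm).contDiffOn contDiffOn_const

lemma gauge_ne_zero {v : V} (hv : v ≠ 0) (k : Mom) : E.gauge k v ≠ 0 := by
  rw [← norm_ne_zero_iff, E.norm_gauge hm]
  exact norm_ne_zero_iff.2 hv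

lemma Jk_gauge_const (c : Fin 3) (v : V) {r : ℝ} (hr : 0 < r) :
    E.Jk (fun q => E.gauge q v) (r • axis c) =
      Complex.I • E.gauge (r • axis c) (E.spin (axis c) v) := by
  rw [E.Jk_eq hm ((E.contDiff_gauge_const hm v).contDiffAt.differentiableAt (by simp)),
    E.gaugeInv_gauge hm, norm_smul, norm_axis, Real.norm_of_nonneg hr.le, mul_one, smul_smul,
    inv_mul_cancel₀ hr.ne', one_smul]

/-! ### Flatness over the spheres -/

lemma coeff_eq_zero_iff (f : ℝ → ℂ) {r : ℝ} (hr : 0 < r) :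
    f r ^ 2 / (energy m r : ℂ) ^ 2 + (1 - f r ^ 2) / (r : ℂ) ^ 2 = 0 ↔
      f r ^ 2 = ((energy m r / m : ℝ) : ℂ) ^ 2 := by
  have hw : (energy m r : ℂ) ^ 2 = (r : ℂ) ^ 2 + (m : ℂ) ^ 2 := by
    exact_mod_cast energy_sq m r
  have hr0 : (r : ℂ) ≠ 0 := by exact_mod_cast hr.ne'
  have hm0 : (m : ℂ) ≠ 0 := by exact_mod_cast hm.ne'
  have hw0 : (energy m r : ℂ) ≠ 0 := by exact_mod_cast (energy_pos hm r).ne'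
  push_cast
  generalize (energy m r : ℂ) = w at *
  generalize (r : ℂ) = r at *
  rw [div_pow, div_add_div _ _ (pow_ne_zero 2 hw0) (pow_ne_zero 2 hr0), div_eq_zero_iff,
    or_iff_left (by positivity), eq_div_iff (pow_ne_zero 2 hm0), ← sub_eq_zero (b := w ^ 2)]
  rw [← neg_eq_zero]
  refine Eq.congr ?_ rfl
  linear_combination (f _ ^ 2) * hw

/-- Flatness is tested at `r e_c` on the rotation fields about the other two axes (indices modulo 3)
and on the section equal to `v` in the gauge. There `k·(X × Y)` is nonzero and `J_k` acts as `i
S(e_c)`, which does not kill `v`. -/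
lemma sq_eq_of_isS2Flat {f : ℝ → ℂ} (hf : ContDiffOn ℝ ∞ f (Set.Ioi 0)) {c : Fin 3} {v : V}
    (hv : E.spin (axis c) v ≠ 0) (h : IsS2Flat (E.affineComb f)) {r : ℝ} (hr : 0 < r) :
    f r ^ 2 = ((energy m r / m : ℝ) : ℂ) ^ 2 := by
  have ha : axis c ≠ 0 := norm_ne_zero_iff.1 (by rw [norm_axis]; exact one_ne_zero)
  have hk : r • axis c ≠ 0 := smul_ne_zero hr.ne' ha
  have hn : ‖r • axis c‖ = r := by
    rw [norm_smul, norm_axis, Real.norm_of_nonneg hr.le, mul_one]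
  have hX (a : Fin 3) : ContDiffOn ℝ ∞ (fun q => cross (axis a) q) {0}ᶜ :=
    (contDiff_cross_const _).contDiffOn
  have hT (a : Fin 3) : TransverseOn {0}ᶜ (fun q => cross (axis a) q) :=
    fun k _ => inner_cross_self _ k
  have hψ := (E.contDiff_gauge_const hm v).contDiffOn (s := {0}ᶜ)
  have h1 := h _ _ _ (hX (c + 1)) (hX (c + 2)) hψ (hT _) (hT _) _ hk
  rw [E.curvature_affineComb hm isOpen_compl_singleton hf subset_rfl (hX _) (hX _) hψ (hT _) (hT _)
    hk, E.Jk_gauge_const hm c v hr, hn, smul_smul r⁻¹, inv_mul_cancel₀ hr.ne', one_smul,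
    inner_axis_cross, smul_eq_zero, smul_eq_zero, or_iff_left (by
      rw [not_or]; exact ⟨Complex.I_ne_zero, E.gauge_ne_zero hm hv _⟩), mul_eq_zero,
    or_iff_left (by exact_mod_cast pow_ne_zero 2 hr.ne'), mul_eq_zero,
    or_iff_right Complex.I_ne_zero, coeff_eq_zero_iff hm f hr] at h1
  exact h1

lemma isS2Flat_of_sq_eq {f : ℝ → ℂ} (hf : ContDiffOn ℝ ∞ f (Set.Ioi 0))
    (h : ∀ r > 0, f r ^ 2 = ((energy m r / m : ℝ) : ℂ) ^ 2) : IsS2Flat (E.affineComb f) := by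
  intro X Y ψ hX hY hψ hXt hYt k hk
  rw [E.curvature_affineComb hm isOpen_compl_singleton hf subset_rfl hX hY hψ hXt hYt hk,
    (coeff_eq_zero_iff hm f (norm_pos_iff.2 hk)).2 (h _ (norm_pos_iff.2 hk))]
  simp

lemma isS2Flat_iff {f : ℝ → ℂ} (hf : ContDiffOn ℝ ∞ f (Set.Ioi 0)) {c : Fin 3} {v : V}
    (hv : E.spin (axis c) v ≠ 0) : IsS2Flat (E.affineComb f) ↔
      (∀ r > 0, f r = ((energy m r / m : ℝ) : ℂ)) ∨
      (∀ r > 0, f r = -((energy m r / m : ℝ) : ℂ)) := by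
  refine ⟨fun h => ?_, fun h => E.isS2Flat_of_sq_eq hm hf fun r hr => ?_⟩
  · have hc : ContinuousOn (fun r : ℝ => ((energy m r / m : ℝ) : ℂ)) (Set.Ioi 0) := by
      unfold energy
      fun_prop
    exact isPreconnected_Ioi.eq_or_eq_neg_of_sq_eq hf.continuousOn hc
      (fun r hr => E.sq_eq_of_isS2Flat hm hf hv h hr)
      (fun {r} _ => by
        have := energy_pos hm r
        exact_mod_cast (by positivity : energy m r / m ≠ 0))
  · rcases h with h | h <;> simp [h r hr]

/-! ### Behaviour at the origin -/

lemma affineComb_eq_newtonWigner {f : ℝ → ℂ} (h : ∀ r > 0, f r = ((energy m r / m : ℝ) : ℂ))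
    (X : Mom → Mom) {ψ : Mom → V} {k : Mom} (hψ : DifferentiableAt ℝ ψ k) (hk : k ≠ 0) :
    E.affineComb f X ψ k = -(Complex.I • ofComponents E.newtonWigner X ψ k) := by
  rw [E.affineComb_eq hm hψ f hk, E.newtonWigner_eq hm hψ, gaugeConn, gaugeConn]
  have hw0 : (energy m ‖k‖ : ℂ) ≠ 0 := by exact_mod_cast (energy_pos hm ‖k‖).ne'
  have hm0 : (m : ℂ) ≠ 0 := by exact_mod_cast hm.ne'
  have : 1 - f ‖k‖ * m / energy m ‖k‖ = 0 := by
    rw [h _ (norm_pos_iff.2 hk)]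
    push_cast
    field_simp
    ring
  rw [this, zero_div]

lemma newtonWigner_eqOn (X : Mom → Mom) (ψ : Mom → V) (hψ : ContDiffOn ℝ ∞ ψ Set.univ) :
    Set.EqOn (fun k => -(Complex.I • ofComponents E.newtonWigner X ψ k))
      (E.gaugeConn (fun _ => 0) X ψ) Set.univ :=
  fun _ hk => E.newtonWigner_eq hm (differentiableAt_of_mem isOpen_univ hψ hk) X

lemma newtonWigner_isConnectionOn : IsConnectionOn Set.univ
    (fun X ψ k => -(Complex.I • ofComponents E.newtonWigner X ψ k)) :=
  (E.gaugeConn_isConnectionOn hm isOpen_univ contDiffOn_const).of_eqOn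
    fun X ψ _ hψ => E.newtonWigner_eqOn hm X ψ hψ

lemma newtonWigner_isFlatOn : IsFlatOn Set.univ
    (fun X ψ k => -(Complex.I • ofComponents E.newtonWigner X ψ k)) := by
  intro X Y ψ hX hY hψ k hk
  rw [(E.gaugeConn_isConnectionOn hm isOpen_univ contDiffOn_const).curvature_congr isOpen_univ
      (fun X ψ _ hψ => E.newtonWigner_eqOn hm X ψ hψ) hX hY hψ hk,
    E.curvature_gaugeConn hm isOpen_univ contDiffOn_const hX hY hψ hk]
  simp

/-- Here the spin coefficient is `2/r²`. At `k = t e_{c+2}` the constant field `e_{c+1}` is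
orthogonal to `k`, and the section is constant in the gauge, so only the spin term survives; its
norm is `2s/t`. -/
lemma affineComb_unbounded {f : ℝ → ℂ} (h : ∀ r > 0, f r = -((energy m r / m : ℝ) : ℂ))
    {c : Fin 3} {v : V} (hv : E.spin (axis c) v ≠ 0) (C : ℝ) {δ : ℝ} (hδ : 0 < δ) :
    ∃ k : Mom, k ≠ 0 ∧ ‖k‖ < δ ∧
      C < ‖E.affineComb f (fun _ => axis (c + 1)) (fun q => E.gauge q v) k‖ := by
  set s := ‖E.spin (axis c) v‖ with hs
  have hs0 : 0 < s := norm_pos_iff.2 hv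
  -- The second bound gives `2s/t ≥ 2(|C| + 1) > C`; the first keeps the point inside the ball of
  -- radius `δ`.
  set t := min (δ / 2) (s / (|C| + 1)) with ht
  have hC : 0 < |C| + 1 := by positivity
  have ht0 : 0 < t := lt_min (by positivity) (by positivity)
  have ha : axis (c + 2) ≠ 0 := norm_ne_zero_iff.1 (by rw [norm_axis]; exact one_ne_zero)
  have hk : t • axis (c + 2) ≠ 0 := smul_ne_zero ht0.ne' ha
  have hn : ‖t • axis (c + 2)‖ = t := by
    rw [norm_smul, norm_axis, Real.norm_of_nonneg ht0.le, mul_one]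
  refine ⟨t • axis (c + 2), hk, ?_, ?_⟩
  · rw [hn]
    exact (min_le_left _ _).trans_lt (by linarith)
  have hcross : cross (axis (c + 1)) (t • axis (c + 2)) = t • axis c := by
    rw [← crossL_apply, map_smul, crossL_apply, cross_axis_axis]
  have hw0 : (energy m t : ℂ) ≠ 0 := by exact_mod_cast (energy_pos hm t).ne'
  have hm0 : (m : ℂ) ≠ 0 := by exact_mod_cast hm.ne'
  have ht0' : (t : ℂ) ≠ 0 := by exact_mod_cast ht0.ne'
  have hco : (1 - f t * m / energy m t) / (t : ℂ) ^ 2 * t = ((2 / t : ℝ) : ℂ) := by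
    rw [h t ht0]
    push_cast
    field_simp
    ring
  rw [E.affineComb_eq hm ((E.contDiff_gauge_const hm v).contDiffAt.differentiableAt (by simp)) f hk,
    gaugeConn, E.gaugeInv_const hm, E.gaugeInv_gauge hm, hn, hcross, inner_smul_right,
    inner_axis_axis, map_smul, E.norm_gauge hm, fderiv_const_apply, zero_apply, mul_zero,
    zero_mul, Complex.ofReal_zero, zero_smul, sub_zero, zero_add, smul_apply, ← Complex.coe_smul,
    smul_smul, hco, norm_smul, Complex.norm_real, Real.norm_of_nonneg (by positivity), ← hs]
  have h2 : t * (|C| + 1) ≤ s := by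
    rw [← le_div_iff₀ hC]
    exact min_le_right _ _
  rw [div_mul_eq_mul_div, lt_div_iff₀ ht0]
  nlinarith [le_abs_self C, abs_nonneg C]

/-- A regular extension would send this smooth field and section to a section continuous at `0`,
hence bounded nearby. -/
lemma not_isRegularAtOrigin {f : ℝ → ℂ} (h : ∀ r > 0, f r = -((energy m r / m : ℝ) : ℂ))
    {c : Fin 3} {v : V} (hv : E.spin (axis c) v ≠ 0) : ¬ IsRegularAtOrigin (E.affineComb f) := by
  rintro ⟨D, hD, heq⟩
  have hψ := E.contDiff_gauge_const hm v
  have hX : ContDiff ℝ ∞ fun _ : Mom => axis (c + 1) := contDiff_const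
  have hs := (hD.smooth _ _ hX.contDiffOn hψ.contDiffOn).continuousOn
  rw [continuousOn_univ] at hs
  have hb := (hs.continuousAt (x := 0)).norm.eventually_lt_const (lt_add_one _)
  obtain ⟨δ, hδ, hball⟩ := Metric.eventually_nhds_iff.1 hb
  obtain ⟨k, hk, hkδ, hlt⟩ := E.affineComb_unbounded hm h hv _ hδ
  rw [heq _ _ hX hψ k hk] at hlt
  exact lt_asymm hlt (hball (by simpa using hkδ))

lemma isS2Flat_and_isRegularAtOrigin_iff {f : ℝ → ℂ} (hf : ContDiffOn ℝ ∞ f (Set.Ioi 0))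
    {c : Fin 3} {v : V} (hv : E.spin (axis c) v ≠ 0) :
    IsS2Flat (E.affineComb f) ∧ IsRegularAtOrigin (E.affineComb f) ↔
      ∀ r > 0, f r = ((energy m r / m : ℝ) : ℂ) := by
  rw [E.isS2Flat_iff hm hf hv]
  refine ⟨fun ⟨h, hreg⟩ => h.resolve_right fun h' => E.not_isRegularAtOrigin hm h' hv hreg,
    fun h => ⟨Or.inl h, _, E.newtonWigner_isConnectionOn hm, fun X ψ _ hψ k hk => ?_⟩⟩
  exact E.affineComb_eq_newtonWigner hm h X (hψ.contDiffAt.differentiableAt (by simp)) hk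

end Bundle

end Particle

end

theorem mainTheorem3 {V : Type*} [NormedAddCommGroup V] [InnerProductSpace ℂ V]
    [FiniteDimensional ℂ V] (m : ℝ) (hm : 0 < m) (E : Particle.Bundle m V) :
    -- `D^f` is a connection over `ℝ³ ∖ {0}`, and its `S²`-curvature
    (∀ f : ℝ → ℂ, ContDiffOn ℝ ∞ f (Set.Ioi 0) →
      Particle.IsConnectionOn {0}ᶜ (E.affineComb f) ∧
      (∀ (U : Set Particle.Mom) (X Y : Particle.Mom → Particle.Mom) (ψ : Particle.Mom → V),
        IsOpen U → U ⊆ {0}ᶜ →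
        ContDiffOn ℝ ∞ X U → ContDiffOn ℝ ∞ Y U → ContDiffOn ℝ ∞ ψ U →
        Particle.TransverseOn U X → Particle.TransverseOn U Y → ∀ k ∈ U,
          Particle.curvature (E.affineComb f) X Y ψ k =
            (Complex.I * (f ‖k‖ ^ 2 / (Particle.energy m ‖k‖ : ℂ) ^ 2
                + (1 - f ‖k‖ ^ 2) / (‖k‖ : ℂ) ^ 2)
              * ((inner ℝ (‖k‖⁻¹ • k) (Particle.cross (X k) (Y k)) : ℝ) : ℂ)) • E.Jk ψ k) ∧
      (∀ ψ : Particle.Mom → V, ContDiffOn ℝ ∞ ψ {0}ᶜ →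
        ∀ k : Particle.Mom, k 0 ^ 2 + k 1 ^ 2 ≠ 0 →
          Particle.curvature (E.affineComb f) Particle.eTheta Particle.ePhi ψ k =
            (Complex.I * (f ‖k‖ ^ 2 / (Particle.energy m ‖k‖ : ℂ) ^ 2
                + (1 - f ‖k‖ ^ 2) / (‖k‖ : ℂ) ^ 2)) • E.Jk ψ k)) ∧
    -- spin at least one: `D^f` is `S²`-flat exactly for `f = ± H / m`, and among these only
    -- `f = H / m` gives a connection that is regular at the origin
    (1 < Module.finrank ℂ V →
      (∀ f : ℝ → ℂ, ContDiffOn ℝ ∞ f (Set.Ioi 0) →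
        (Particle.IsS2Flat (E.affineComb f) ↔
          (∀ r > 0, f r = ((Particle.energy m r / m : ℝ) : ℂ)) ∨
          (∀ r > 0, f r = -((Particle.energy m r / m : ℝ) : ℂ))) ∧
        (Particle.IsS2Flat (E.affineComb f) ∧ Particle.IsRegularAtOrigin (E.affineComb f) ↔
          ∀ r > 0, f r = ((Particle.energy m r / m : ℝ) : ℂ))) ∧
      (∃ (X : Particle.Mom → Particle.Mom) (ψ : Particle.Mom → V),
        ContDiff ℝ ∞ X ∧ ContDiff ℝ ∞ ψ ∧
        ∀ C : ℝ, ∀ δ > 0, ∃ k : Particle.Mom, k ≠ 0 ∧ ‖k‖ < δ ∧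
          C < ‖E.affineComb (fun r => -((Particle.energy m r / m : ℝ) : ℂ)) X ψ k‖)) ∧
    -- `i D⁺` is the Newton-Wigner operator, and `D⁺` extends to a flat connection over all of `ℝ³`
    ((∀ X ψ, ContDiffOn ℝ ∞ X {0}ᶜ → ContDiffOn ℝ ∞ ψ {0}ᶜ → ∀ k ≠ 0,
        Complex.I • E.affineComb (fun r => ((Particle.energy m r / m : ℝ) : ℂ)) X ψ k =
          Particle.ofComponents E.newtonWigner X ψ k) ∧
      Particle.IsConnectionOn Set.univ (fun X ψ k =>
        -(Complex.I • Particle.ofComponents E.newtonWigner X ψ k)) ∧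
      Particle.IsFlatOn Set.univ (fun X ψ k =>
        -(Complex.I • Particle.ofComponents E.newtonWigner X ψ k))) := by
  refine ⟨fun f hf => ⟨?_, ?_, ?_⟩, fun hV => ?_, ?_, E.newtonWigner_isConnectionOn hm,
    E.newtonWigner_isFlatOn hm⟩
  · exact (E.gaugeConn_isConnectionOn hm isOpen_compl_singleton
      (E.coeff_norm_contDiffOn hm hf)).of_eqOn
      fun X ψ _ hψ => E.affineComb_eqOn hm isOpen_compl_singleton f subset_rfl X ψ hψ
  · intro U X Y ψ hU h0 hX hY hψ hXt hYt k hk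
    exact E.curvature_affineComb hm hU hf h0 hX hY hψ hXt hYt hk
  · intro ψ hψ k hk
    -- The spherical unit vectors are smooth only off the third axis, which is why the curvature
    -- formula is proved over arbitrary open subsets.
    rw [E.curvature_affineComb hm Particle.isOpen_off_axis hf Particle.off_axis_subset
      Particle.contDiffOn_eTheta Particle.contDiffOn_ePhi (hψ.mono Particle.off_axis_subset)
      Particle.transverseOn_eTheta (Particle.transverseOn_ePhi _) hk,
      Particle.inner_cross_eTheta_ePhi hk, Complex.ofReal_one, mul_one]
  · obtain ⟨c, v, hv⟩ := E.exists_spin_ne_zero hm hV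
    exact ⟨fun f hf => ⟨E.isS2Flat_iff hm hf hv, E.isS2Flat_and_isRegularAtOrigin_iff hm hf hv⟩,
      _, _, contDiff_const, E.contDiff_gauge_const hm v,
      fun C δ hδ => E.affineComb_unbounded hm (fun _ _ => rfl) hv C hδ⟩
  · intro X ψ _ hψ k hk
    rw [E.affineComb_eq_newtonWigner hm (fun _ _ => rfl) X
      (Particle.Bundle.differentiableAt_of_mem isOpen_compl_singleton hψ hk) hk, smul_neg,
      smul_smul, Complex.I_mul_I, neg_one_smul, neg_neg]
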